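/- Jobs $k=0,1,2,\dots$, numbered in order of arrival, arrive at times $a_k\ge 0$ with service demand $\sigma_k$ and sojourn time $\tau_k$; $\{(a_k;\sigma_k,\tau_k)\}$ is an independently marked stationary Poisson point process on $[0,\infty)$ with arrival rate $\Lambda>0$, where the mark law (the joint law of $(\sigma,\tau)$) is a probability measure carried by a bounded set $S\subset\{(\sigma,\tau): 0\le\sigma\le\tau\}$. A service profile gives each job $k$ a service rate $r_k(t)$, the service capacity is $P(t)=\sum_k r_k(t)$, and $y_k(t)=\sigma_k-\int_{a_k}^t r_k(s)\,ds$ and $x_k(t)=a_k+\tau_k-t$ are the remaining demand and the remaining time of job $k$. The stationary variance of $P(t)$ is the variance of its limit law as $t\to\infty$. Exact Scheduling is the policy that serves each job from its arrival on at rate $r_k(t)=y_k(t)/x_k(t)$ if $x_k(t)>0$ and $r_k(t)=0$ otherwise (with $r_k(t)=0$ before arrival). A centralized online policy has the form $r_k(t)=u(k,t,A_t)$ with $u$ deterministic and $A_t=\{(a_j,\sigma_j,\tau_j,y_j(t),x_j(t)): a_j\le t\}$ the information on all jobs that arrived no later than $t$, so that $r_k(t)$ is determined by the jobs arriving up to time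 $t$. Let $\mathrm{Var}(P^\dagger)$ be the infimum of the stationary variance of $P(t)$ over the centralized online policies for which $P(t)$ has a stationary variance and which satisfy, almost surely, for all $k$ and $t$, the rate constraint $r_k(t)\in[0,1]$, the demand constraint $\int_{a_k}^\infty r_k(t)\,dt=\sigma_k$ and the deadline constraint $r_k(t)\le \mathbf 1\{a_k\le t<a_k+\tau_k\}$. Then there are service rates that follow Exact Scheduling, under any such rates $P(t)$ has a stationary variance $\mathrm{Var}(P)$, and $$\mathrm{Var}(P)\le \frac{4\,\mathbb E[\sigma^2/\tau]\,\bigl(\mathbb E[\tau\sigma^2]+\Lambda\,\mathbb E[\tau\sigma]^2\bigr)}{\mathbb E[\sigma^2]^2}\;\mathrm{Var}(P^\dagger).$$ The same inequality holds with $\mathrm{Var}(P^\dagger)$ replaced by the infimum of $\liminf_{T\to\infty}\frac1T\int_0^T\mathrm{Var}(P(t))\,dt$ over all centralized online policies that satisfy these constraints. (Here $\sigma^2/\tau$ is read as $0$ when $\tau=0$, and the fraction as $0$ when $\mathbb E[\sigma^2]=0$.) -/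

import Mathlib

open MeasureTheory ProbabilityTheory Filter Topology

/-- The random number of indices `k` with `z k ω ∈ B`, for a random sequence of points `z`. -/
noncomputable def pointCount {Ω E : Type*} (z : ℕ → Ω → E) (B : Set E) (ω : Ω) : ENNReal :=
  ∑' k, B.indicator (fun _ => (1 : ENNReal)) (z k ω)

/-- `z` enumerates the points of a Poisson point process with intensity measure `m`: the number of
points in a measurable set of finite intensity is Poisson distributed with parameter the intensity
of the set, and the numbers of points in disjoint measurable sets are independent. -/
structure IsPoissonPointProcess {Ω E : Type*} [MeasurableSpace Ω] [MeasurableSpace E]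
    (μ : Measure Ω) (z : ℕ → Ω → E) (m : Measure E) : Prop where
  measurable_point : ∀ k, Measurable (z k)
  hasLaw_count : ∀ B : Set E, MeasurableSet B → m B < ⊤ →
    HasLaw (pointCount z B)
      ((poissonMeasure (m B).toNNReal).map (fun n : ℕ => (n : ENNReal))) μ
  indep_count : ∀ (n : ℕ) (B : Fin n → Set E), (∀ i, MeasurableSet (B i)) →
    Pairwise (fun i j => Disjoint (B i) (B j)) →
    iIndepFun (fun i => pointCount z (B i)) μ

/-- A random sequence of jobs: job `k` arrives at time `arrival k`, has service demand `demand k`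
and sojourn time `sojourn k`, so that its deadline is `arrival k + sojourn k`. -/
structure JobStream (Ω : Type*) where
  arrival : ℕ → Ω → ℝ
  demand : ℕ → Ω → ℝ
  sojourn : ℕ → Ω → ℝ

namespace JobStream

variable {Ω : Type*}

/-- Job `k` as a point (arrival time; demand, sojourn time). -/
def job (J : JobStream Ω) (k : ℕ) (ω : Ω) : ℝ × ℝ × ℝ :=
  (J.arrival k ω, J.demand k ω, J.sojourn k ω)

/-- Independently marked stationary Poisson arrivals on `[0, ∞)` with arrival rate `rate` and mark
law `ν` (the joint law of demand and sojourn time); the jobs are numbered in the order in which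
they arrive. -/
structure IsStationaryPoisson [MeasurableSpace Ω] (J : JobStream Ω) (μ : Measure Ω)
    (rate : ℝ) (ν : Measure (ℝ × ℝ)) : Prop where
  poisson : IsPoissonPointProcess μ J.job
    ((ENNReal.ofReal rate • volume.restrict (Set.Ici (0 : ℝ))).prod ν)
  ordered : ∀ᵐ ω ∂μ, StrictMono (fun k => J.arrival k ω)

/-- The events that depend only on the jobs arriving no later than `t`. -/
abbrev past (J : JobStream Ω) (t : ℝ) : MeasurableSpace Ω :=
  MeasurableSpace.generateFrom
    {E | ∃ (k : ℕ) (B : Set (ℝ × ℝ × ℝ)), MeasurableSet B ∧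
      E = {ω | J.arrival k ω ≤ t ∧ J.job k ω ∈ B}}

/-! A service profile `r` gives the service rate `r k t ω` of job `k` at time `t`. -/

/-- Remaining demand of job `k` at a time `t` after its arrival. -/
noncomputable def remainingDemand (J : JobStream Ω) (r : ℕ → ℝ → Ω → ℝ) (k : ℕ) (t : ℝ) (ω : Ω) :
    ℝ :=
  J.demand k ω - ∫ s in (J.arrival k ω)..t, r k s ω

/-- Remaining time of job `k` at time `t`. -/
def remainingTime (J : JobStream Ω) (k : ℕ) (t : ℝ) (ω : Ω) : ℝ :=
  J.arrival k ω + J.sojourn k ω - t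

end JobStream

/-- The service capacity `P(t)`, the sum of all service rates at time `t`. -/
noncomputable def capacity {Ω : Type*} (r : ℕ → ℝ → Ω → ℝ) (t : ℝ) (ω : Ω) : ℝ :=
  ∑' k, r k t ω

/-- What a centralized scheduler knows about one job at a given time. -/
structure JobInfo where
  label : ℕ
  arrival : ℝ
  demand : ℝ
  sojourn : ℝ
  remDemand : ℝ
  remTime : ℝ

namespace JobStream

variable {Ω : Type*}

/-- The information at time `t`: the data of all jobs that arrived no later than `t`. -/
noncomputable def info (J : JobStream Ω) (r : ℕ → ℝ → Ω → ℝ) (t : ℝ) (ω : Ω) : Set JobInfo :=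
  {p | ∃ k, J.arrival k ω ≤ t ∧
    p = ⟨k, J.arrival k ω, J.demand k ω, J.sojourn k ω, J.remainingDemand r k t ω,
      J.remainingTime k t ω⟩}

/-- `r` is produced by a centralized online policy: the rate of each job at time `t` is a
deterministic function of the information at time `t`. The last condition says that the random rate
at time `t` is determined by the jobs arriving no later than `t`; it is needed besides the first
because the information contains remaining demands, which depend on `r` itself. -/
structure IsCentralizedOnline [MeasurableSpace Ω] (J : JobStream Ω) (μ : Measure Ω)
    (r : ℕ → ℝ → Ω → ℝ) : Prop where
  form : ∃ u : ℕ → ℝ → Set JobInfo → ℝ,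
    ∀ᵐ ω ∂μ, ∀ k t, r k t ω = u k t (J.info r t ω)
  measurable : ∀ k, Measurable (fun p : ℝ × Ω => r k p.1 p.2)
  adapted : ∀ k t, Measurable[J.past t] (r k t)

/-- The rate, demand and deadline constraints. -/
structure MeetsConstraints [MeasurableSpace Ω] (J : JobStream Ω) (μ : Measure Ω)
    (r : ℕ → ℝ → Ω → ℝ) : Prop where
  rate : ∀ᵐ ω ∂μ, ∀ k t, r k t ω ∈ Set.Icc (0 : ℝ) 1
  demand : ∀ᵐ ω ∂μ, ∀ k, ∫ t in Set.Ici (J.arrival k ω), r k t ω = J.demand k ω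
  deadline : ∀ᵐ ω ∂μ, ∀ k t, r k t ω ≤
    (Set.Ico (J.arrival k ω) (J.arrival k ω + J.sojourn k ω)).indicator (fun _ => (1 : ℝ)) t

/-- `r` is produced by the distributed policy `u`: after its arrival, a job is served at rate
`u y x`, where `y` is its remaining demand and `x` its remaining time. -/
structure FollowsDistributed (J : JobStream Ω) (u : ℝ → ℝ → ℝ) (r : ℕ → ℝ → Ω → ℝ) : Prop where
  integrable : ∀ k ω, Integrable (fun t => r k t ω)
  after : ∀ k t ω, J.arrival k ω ≤ t →
    r k t ω = u (J.remainingDemand r k t ω) (J.remainingTime k t ω)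
  before : ∀ k t ω, t < J.arrival k ω → r k t ω = 0

end JobStream

/-- Exact Scheduling: remaining demand over remaining time, as long as there is time left. -/
noncomputable def exactScheduling (y x : ℝ) : ℝ := if 0 < x then y / x else 0

/-- The real process `P` has stationary variance `v`: as `t → ∞`, `P t` converges in distribution
to a (stationary) law with finite second moment and variance `v`. -/
def HasStationaryVariance {Ω : Type*} [MeasurableSpace Ω] (μ : Measure Ω) [IsProbabilityMeasure μ]
    (P : ℝ → Ω → ℝ) (v : ℝ) : Prop :=
  ∃ (π : Measure ℝ) (_ : IsProbabilityMeasure π),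
    TendstoInDistribution P atTop (id : ℝ → ℝ) (fun _ => μ) π ∧
      MemLp (id : ℝ → ℝ) 2 π ∧ Var[(id : ℝ → ℝ); π] = v

/-- The long-run average of the variance, `liminf (1/T) ∫₀ᵀ Var (P t) dt` as `T → ∞`. -/
noncomputable def longRunVariance {Ω : Type*} [MeasurableSpace Ω] (μ : Measure Ω)
    (P : ℝ → Ω → ℝ) : ℝ :=
  liminf (fun T : ℝ => (1 / T) * ∫ t in (0 : ℝ)..T, Var[P t; μ]) atTop

/-- The optimal stationary variance of the service capacity among the centralized online policies
that satisfy the constraints. -/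
noncomputable def optimalCentralizedVariance {Ω : Type*} [MeasurableSpace Ω] (μ : Measure Ω)
    [IsProbabilityMeasure μ] (J : JobStream Ω) : ℝ :=
  sInf {v | ∃ r, J.IsCentralizedOnline μ r ∧ J.MeetsConstraints μ r ∧
    HasStationaryVariance μ (capacity r) v}

/-- The optimal long-run average variance of the service capacity among the centralized online
policies that satisfy the constraints, whether or not the capacity has a stationary law. -/
noncomputable def optimalCentralizedLongRunVariance {Ω : Type*} [MeasurableSpace Ω]
    (μ : Measure Ω) (J : JobStream Ω) : ℝ :=
  sInf {v | ∃ r, J.IsCentralizedOnline μ r ∧ J.MeetsConstraints μ r ∧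
    v = longRunVariance μ (capacity r)}

/-! ### Moments of the Poisson distribution -/

/-! Let `A t` be the demand that has arrived by time `t`, `P` the capacity, and `D = Λ E[τσ²] + (Λ
E[τσ])²`. The constraints keep the backlog `A t - ∫₀ᵗ P` between 0 and the total demand of the jobs
present, whose second moment is at most `D` at all times. But `Var (A T) = T Λ E[σ²]` grows
linearly, so `∫ P` has to follow `A`; an online policy can do so only by reacting to past arrivals,
and that forces `P` to fluctuate.

To quantify this, let `M = A - E A`, `c = P - E P` and `Y s = ∫₀ˢ c`. Integration by parts gives `(M
T - Y T)² = M T² - 2 ∫₀ᵀ (M T - Y s) c s ds`. The increment `M T - M s` is independent of the past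
at `s`, hence uncorrelated with `c s`, so `M T` may be replaced by `M s` under the expectation.
Since `E (M s - Y s)² ≤ D`, the inequality `2xy ≤ λx² + y²/λ` yields `T Λ E[σ²] ≤ D + λ D T + λ⁻¹
∫₀ᵀ Var (P s) ds`. Dividing by `T`, letting `T → ∞` and optimising over `λ` gives `(Λ E[σ²])² ≤ 4 D
V` for the long-run variance `V` (`integral_sq_le_of_energy`, `mul_integral_sq_le_of_online`,
`sq_le_mul_liminf_average`). A stationary variance dominates `V`, because the fourth moments of `P
t` are uniformly bounded (`longRunVariance_le_of_hasStationaryVariance`).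

Under Exact Scheduling every job is served at the constant rate `σ/τ` (`eq_div_of_exactScheduling`).
The capacity is then a sum over the points of a Poisson process whose law is constant once `t`
exceeds the largest sojourn time (`map_jobSum_exactRate_eq`), and Campbell's formula gives the
variance `Λ E[(σ/τ)² τ] = Λ E[σ²/τ]`. The quotient of this value and the lower bound is the stated
factor.

The process is given only through its counts, so Campbell's formulas, the independence of past and
future, and the law of a point sum are all derived from counts. -/

lemma lintegral_poissonMeasure_natCast_mul (r : NNReal) (g : ℕ → ENNReal) :
    ∫⁻ n, (n : ENNReal) * g n ∂(poissonMeasure r) = r * ∫⁻ n, g (n + 1) ∂(poissonMeasure r) := by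
  rw [lintegral_countable', lintegral_countable', tsum_eq_zero_add' ENNReal.summable,
    ← ENNReal.tsum_mul_left]
  simp only [Nat.cast_zero, zero_mul, zero_add]
  refine tsum_congr fun n => ?_
  -- The size-bias identity of the Poisson weights; every moment below follows from it by recursion.
  have h : ((n + 1 : ℕ) : ENNReal) * poissonMeasure r {n + 1} = r * poissonMeasure r {n} := by
    rw [poissonMeasure_singleton, poissonMeasure_singleton, ← ENNReal.ofReal_coe_nnreal,
      ← ENNReal.ofReal_natCast, ← ENNReal.ofReal_mul (by positivity),
      ← ENNReal.ofReal_mul (by positivity)]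
    congr 1
    rw [Nat.factorial_succ, pow_succ]
    push_cast
    field_simp
  calc _ = g (n + 1) * (((n + 1 : ℕ) : ENNReal) * poissonMeasure r {n + 1}) := by ring
    _ = _ := by rw [h]; ring

lemma lintegral_poissonMeasure_natCast (r : NNReal) :
    ∫⁻ n, (n : ENNReal) ∂(poissonMeasure r) = r := by
  simpa using lintegral_poissonMeasure_natCast_mul r 1

lemma lintegral_poissonMeasure_natCast_sq (r : NNReal) :
    ∫⁻ n, (n : ENNReal) ^ 2 ∂(poissonMeasure r) = r + r ^ 2 := by
  have h := lintegral_poissonMeasure_natCast_mul r (fun n => (n : ENNReal))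
  simp only [Nat.cast_add, Nat.cast_one] at h
  rw [lintegral_add_right _ measurable_const, lintegral_poissonMeasure_natCast] at h
  simp only [sq]
  rw [h]
  simp [mul_add, add_comm]

lemma exists_lintegral_poissonMeasure_pow_four_le (b : NNReal) :
    ∃ C : NNReal, ∀ r : NNReal, r ≤ b →
      ∫⁻ n, (n : ENNReal) ^ 4 ∂(poissonMeasure r) ≤ C := by
  -- The fourth moment is `r + 7r² + 6r³ + r⁴`, which increases with `r`.
  refine ⟨(b * (1 + 7 * b + 6 * b ^ 2 + b ^ 3)), fun r hr => ?_⟩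
  have h1 := lintegral_poissonMeasure_natCast_mul r (fun n => (n : ENNReal) ^ 3)
  have h2 := lintegral_poissonMeasure_natCast_mul r (fun n => (n : ENNReal) ^ 2)
  have e1 : ∀ n : ℕ, (n : ENNReal) * n ^ 3 = n ^ 4 := fun n => by ring
  have e2 : ∀ n : ℕ, (n : ENNReal) * n ^ 2 = n ^ 3 := fun n => by ring
  have e3 : ∀ n : ℕ, ((n + 1 : ℕ) : ENNReal) ^ 3 = n ^ 3 + 3 * n ^ 2 + 3 * n + 1 := fun n => by
    push_cast; ring
  have e4 : ∀ n : ℕ, ((n + 1 : ℕ) : ENNReal) ^ 2 = n ^ 2 + 2 * n + 1 := fun n => by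
    push_cast; ring
  simp only [e1, e3] at h1
  simp only [e2, e4] at h2
  have m : ∀ f : ℕ → ENNReal, Measurable f := fun f => by fun_prop
  rw [lintegral_add_left (m _), lintegral_add_left (m _), lintegral_const_mul _ (m _),
    lintegral_poissonMeasure_natCast, lintegral_poissonMeasure_natCast_sq] at h2
  rw [lintegral_add_left (m _), lintegral_add_left (m _), lintegral_add_left (m _),
    lintegral_const_mul _ (m _), lintegral_const_mul _ (m _),
    lintegral_poissonMeasure_natCast, lintegral_poissonMeasure_natCast_sq, h2] at h1
  rw [h1]
  simp only [lintegral_const, measure_univ, mul_one]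
  calc _ = (r : ENNReal) * (1 + 7 * r + 6 * r ^ 2 + r ^ 3) := by ring
    _ ≤ (b : ENNReal) * (1 + 7 * b + 6 * b ^ 2 + b ^ 3) := by gcongr
    _ = _ := by push_cast; rfl

/-! ### Sums over the points of a Poisson point process -/

section PointSums

variable {Ω E : Type*} [MeasurableSpace Ω] [MeasurableSpace E] {μ : Measure Ω} {z : ℕ → Ω → E}
  {m : Measure E}

lemma measurable_pointCount (hz : ∀ k, Measurable (z k)) {B : Set E} (hB : MeasurableSet B) :
    Measurable (pointCount z B) := by
  unfold pointCount
  exact Measurable.tsum fun k => (measurable_const.indicator hB).comp (hz k)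

omit [MeasurableSpace Ω] [MeasurableSpace E] in
lemma pointCount_union {A B : Set E} (h : Disjoint A B) (ω : Ω) :
    pointCount z (A ∪ B) ω = pointCount z A ω + pointCount z B ω := by
  unfold pointCount
  rw [← ENNReal.tsum_add, Set.indicator_union_of_disjoint h]

/-- As a function of `B`, the weighted mean count is itself a measure `κ`, a sum of pushforwards of
`w • μ`. Agreement with `ρ` on subsets of `K` therefore extends to all integrands supported in `K`.
-/
lemma lintegral_mul_tsum_comp (hz : ∀ k, Measurable (z k)) {w : Ω → ENNReal} (hw : Measurable w)
    {K : Set E} (hK : MeasurableSet K) {ρ : Measure E}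
    (h : ∀ B, MeasurableSet B → B ⊆ K → ∫⁻ ω, w ω * pointCount z B ω ∂μ = ρ B)
    {g : E → ENNReal} (hg : Measurable g) (hgK : ∀ x, x ∉ K → g x = 0) :
    ∫⁻ ω, w ω * ∑' k, g (z k ω) ∂μ = ∫⁻ x, g x ∂ρ := by
  set κ : Measure E := Measure.sum fun k => (μ.withDensity w).map (z k) with hκ
  have key : ∀ f : E → ENNReal, Measurable f →
      ∫⁻ ω, w ω * ∑' k, f (z k ω) ∂μ = ∫⁻ x, f x ∂κ := by
    intro f hf
    rw [hκ, lintegral_sum_measure]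
    simp_rw [← ENNReal.tsum_mul_left]
    rw [lintegral_tsum (f := fun k ω => w ω * f (z k ω))
      fun k => (hw.mul (hf.comp (hz k))).aemeasurable]
    refine tsum_congr fun k => ?_
    rw [lintegral_map hf (hz k)]
    exact (lintegral_withDensity_eq_lintegral_mul μ hw (hf.comp (hz k))).symm
  have hrestr : κ.restrict K = ρ.restrict K := by
    ext B hB
    rw [Measure.restrict_apply hB, Measure.restrict_apply hB,
      ← h _ (hB.inter hK) Set.inter_subset_right, ← lintegral_indicator_one (hB.inter hK),
      ← key _ (measurable_one.indicator (hB.inter hK))]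
    rfl
  have hind : K.indicator g = g := Set.indicator_eq_self.2 fun x hx => by
    by_contra hxK
    exact hx (hgK x hxK)
  rw [key g hg, ← hind, lintegral_indicator hK, lintegral_indicator hK, hrestr]

namespace IsPoissonPointProcess

variable (hz : IsPoissonPointProcess μ z m)
include hz

lemma lintegral_comp_pointCount {B : Set E} (hB : MeasurableSet B) (hm : m B < ⊤)
    {g : ENNReal → ENNReal} (hg : Measurable g) :
    ∫⁻ ω, g (pointCount z B ω) ∂μ = ∫⁻ n, g n ∂(poissonMeasure (m B).toNNReal) := by
  have h := (hz.hasLaw_count B hB hm).map_eq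
  rw [← lintegral_map hg (measurable_pointCount hz.measurable_point hB), h,
    lintegral_map hg (by fun_prop)]

lemma lintegral_pointCount {B : Set E} (hB : MeasurableSet B) (hm : m B < ⊤) :
    ∫⁻ ω, pointCount z B ω ∂μ = m B := by
  rw [hz.lintegral_comp_pointCount hB hm (g := fun x => x) measurable_id]
  simp only [lintegral_poissonMeasure_natCast, ENNReal.coe_toNNReal hm.ne]

lemma lintegral_pointCount_sq {B : Set E} (hB : MeasurableSet B) (hm : m B < ⊤) :
    ∫⁻ ω, pointCount z B ω ^ 2 ∂μ = m B + m B ^ 2 := by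
  rw [hz.lintegral_comp_pointCount hB hm (g := fun x => x ^ 2) (measurable_id.pow_const 2)]
  simp only [lintegral_poissonMeasure_natCast_sq, ENNReal.coe_toNNReal hm.ne]

lemma exists_lintegral_pointCount_pow_four_le (b : NNReal) :
    ∃ C : NNReal, ∀ B, MeasurableSet B → m B ≤ b → ∫⁻ ω, pointCount z B ω ^ 4 ∂μ ≤ C := by
  obtain ⟨C, hC⟩ := exists_lintegral_poissonMeasure_pow_four_le b
  refine ⟨C, fun B hB hm => ?_⟩
  have hlt : m B < ⊤ := hm.trans_lt ENNReal.coe_lt_top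
  rw [hz.lintegral_comp_pointCount hB hlt (g := fun x => x ^ 4) (measurable_id.pow_const 4)]
  refine hC _ ?_
  rw [← ENNReal.coe_le_coe, ENNReal.coe_toNNReal hlt.ne]
  exact hm

lemma iIndepFun_pointCount {ι : Type*} [Finite ι] (F : ι → Set E)
    (hF : ∀ i, MeasurableSet (F i)) (hd : Pairwise fun i j => Disjoint (F i) (F j)) :
    iIndepFun (fun i => pointCount z (F i)) μ := by
  obtain ⟨n, ⟨e⟩⟩ := Finite.exists_equiv_fin ι
  have h := hz.indep_count n (fun i => F (e.symm i)) (fun i => hF _)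
    (fun i j hij => hd (e.symm.injective.ne hij))
  have h2 := h.precomp (g := e) e.injective
  simpa using h2

lemma indepFun_pointCount {A B : Set E} (hA : MeasurableSet A) (hB : MeasurableSet B)
    (h : Disjoint A B) : IndepFun (pointCount z A) (pointCount z B) μ := by
  have := hz.iIndepFun_pointCount (fun b : Bool => bif b then A else B)
    (by rintro (_ | _) <;> assumption)
    (by
      rintro (_ | _) (_ | _) hij
      · exact absurd rfl hij
      · exact h.symm
      · exact h
      · exact absurd rfl hij)
  exact this.indepFun (i := true) (j := false) (by simp)

/-- The sets `A ∩ B`, `A \ B` and `B \ A` are disjoint, so mixed products factorise; only the square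
of the count of `A ∩ B` contributes an extra `m (A ∩ B)`. -/
lemma lintegral_pointCount_mul {A B : Set E} (hA : MeasurableSet A) (hB : MeasurableSet B)
    (hmA : m A < ⊤) (hmB : m B < ⊤) :
    ∫⁻ ω, pointCount z A ω * pointCount z B ω ∂μ = m (A ∩ B) + m A * m B := by
  have hM : ∀ {C : Set E}, MeasurableSet C → Measurable (pointCount z C) :=
    measurable_pointCount hz.measurable_point
  have hX := hA.inter hB
  have hU := hA.diff hB
  have hW := hB.diff hA
  have hmX : m (A ∩ B) < ⊤ := (measure_mono Set.inter_subset_left).trans_lt hmA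
  have hmU : m (A \ B) < ⊤ := (measure_mono Set.sdiff_subset).trans_lt hmA
  have hmW : m (B \ A) < ⊤ := (measure_mono Set.sdiff_subset).trans_lt hmB
  have dXU : Disjoint (A ∩ B) (A \ B) := Set.disjoint_sdiff_inter.symm
  have dXW : Disjoint (A ∩ B) (B \ A) := by
    rw [Set.inter_comm]
    exact Set.disjoint_sdiff_inter.symm
  have dUW : Disjoint (A \ B) (B \ A) := disjoint_sdiff_sdiff
  have eA : A = A ∩ B ∪ A \ B := (Set.inter_union_sdiff A B).symm
  have eB : B = A ∩ B ∪ B \ A := by rw [Set.inter_comm, Set.inter_union_sdiff]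
  have hind : ∀ {C D : Set E}, MeasurableSet C → MeasurableSet D → m C < ⊤ → m D < ⊤ →
      Disjoint C D → ∫⁻ ω, pointCount z C ω * pointCount z D ω ∂μ = m C * m D := by
    intro C D hC hD hmC hmD hCD
    rw [← hz.lintegral_pointCount hC hmC, ← hz.lintegral_pointCount hD hmD]
    exact lintegral_mul_eq_lintegral_mul_lintegral_of_indepFun (hM hC) (hM hD)
      (hz.indepFun_pointCount hC hD hCD)
  have e : ∀ ω, pointCount z A ω * pointCount z B ω = pointCount z (A ∩ B) ω ^ 2
      + pointCount z (A ∩ B) ω * pointCount z (B \ A) ω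
      + pointCount z (A ∩ B) ω * pointCount z (A \ B) ω
      + pointCount z (A \ B) ω * pointCount z (B \ A) ω := by
    intro ω
    have h1 := pointCount_union (z := z) dXU ω
    have h2 := pointCount_union (z := z) dXW ω
    rw [← eA] at h1
    rw [← eB] at h2
    rw [h1, h2]
    ring
  have mA : m A = m (A ∩ B) + m (A \ B) := (measure_inter_add_sdiff A hB).symm
  have mB : m B = m (A ∩ B) + m (B \ A) := by
    rw [Set.inter_comm]
    exact (measure_inter_add_sdiff B hA).symm
  simp only [e]
  have hmul : ∀ {C D : Set E}, MeasurableSet C → MeasurableSet D →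
      Measurable fun ω => pointCount z C ω * pointCount z D ω := fun hC hD => (hM hC).mul (hM hD)
  rw [lintegral_add_right _ (hmul hU hW), lintegral_add_right _ (hmul hX hU),
    lintegral_add_right _ (hmul hX hW), hz.lintegral_pointCount_sq hX hmX,
    hind hX hW hmX hmW dXW, hind hX hU hmX hmU dXU, hind hU hW hmU hmW dUW, mA, mB]
  ring

/-- Campbell's formula for the mean of a sum over the points of a Poisson point process. -/
lemma lintegral_tsum_comp {K : Set E} (hK : MeasurableSet K) (hmK : m K < ⊤) {g : E → ENNReal}
    (hg : Measurable g) (hgK : ∀ x, x ∉ K → g x = 0) :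
    ∫⁻ ω, ∑' k, g (z k ω) ∂μ = ∫⁻ x, g x ∂m := by
  have := lintegral_mul_tsum_comp (w := 1) (μ := μ) hz.measurable_point measurable_one hK (ρ := m)
    (fun B hB hBK => by
      simpa using hz.lintegral_pointCount hB ((measure_mono hBK).trans_lt hmK)) hg hgK
  simpa using this

/-- Campbell's formula for the mixed second moment of two sums over the points of a Poisson point
process. -/
lemma lintegral_tsum_comp_mul_tsum_comp {K : Set E} (hK : MeasurableSet K) (hmK : m K < ⊤)
    {f g : E → ENNReal} (hf : Measurable f) (hfK : ∀ x, x ∉ K → f x = 0)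
    (hg : Measurable g) (hgK : ∀ x, x ∉ K → g x = 0) :
    ∫⁻ ω, (∑' k, f (z k ω)) * ∑' k, g (z k ω) ∂μ
      = ∫⁻ x, f x * g x ∂m + (∫⁻ x, f x ∂m) * ∫⁻ x, g x ∂m := by
  have hlt : ∀ {B}, B ⊆ K → m B < ⊤ := fun h => (measure_mono h).trans_lt hmK
  -- The formula for pairs of sets is extended one argument at a time: first the indicator of one
  -- set becomes `f`, then that of the other becomes `g`.
  have step1 : ∀ A, MeasurableSet A → A ⊆ K →
      ∫⁻ ω, (∑' k, f (z k ω)) * pointCount z A ω ∂μ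
        = ∫⁻ x in A, f x ∂m + (∫⁻ x, f x ∂m) * m A := by
    intro A hA hAK
    have := lintegral_mul_tsum_comp (w := pointCount z A) (μ := μ) hz.measurable_point
      (measurable_pointCount hz.measurable_point hA) hK (ρ := m.restrict A + m A • m)
      (fun B hB hBK => by
        rw [hz.lintegral_pointCount_mul hA hB (hlt hAK) (hlt hBK)]
        simp [Measure.restrict_apply hB, Set.inter_comm]) hf hfK
    simp_rw [mul_comm (∑' k, f _)]
    rw [this, lintegral_add_measure, lintegral_smul_measure, smul_eq_mul, mul_comm (m A)]
  have := lintegral_mul_tsum_comp (w := fun ω => ∑' k, f (z k ω)) (μ := μ) hz.measurable_point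
    (Measurable.tsum fun k => hf.comp (hz.measurable_point k)) hK
    (ρ := m.withDensity f + (∫⁻ x, f x ∂m) • m)
    (fun B hB hBK => by
      rw [step1 B hB hBK]
      simp [withDensity_apply f hB]) hg hgK
  rw [this, lintegral_add_measure, lintegral_smul_measure,
    lintegral_withDensity_eq_lintegral_mul _ hf hg]
  rfl

/-- A null set contains no points on average, hence almost surely none. -/
lemma ae_forall_of_ae {p : E → Prop} (hp : ∀ᵐ x ∂m, p x) : ∀ᵐ ω ∂μ, ∀ k, p (z k ω) := by
  obtain ⟨B, hpB, hB, hmB⟩ := exists_measurable_superset_of_null (ae_iff.1 hp)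
  have h := hz.lintegral_pointCount hB (by simp [hmB])
  rw [hmB, lintegral_eq_zero_iff (measurable_pointCount hz.measurable_point hB)] at h
  filter_upwards [h] with ω hω k
  by_contra hk
  have h0 : pointCount z B ω = 0 := hω
  unfold pointCount at h0
  rw [ENNReal.tsum_eq_zero] at h0
  simpa [hpB hk] using h0 k

lemma ae_finite_mem {B : Set E} (hB : MeasurableSet B) (hm : m B < ⊤) :
    ∀ᵐ ω ∂μ, {k | z k ω ∈ B}.Finite := by
  have h := hz.lintegral_pointCount hB hm
  filter_upwards [ae_lt_top (measurable_pointCount hz.measurable_point hB) (h ▸ hm.ne)] with ω hω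
  unfold pointCount at hω
  have := ENNReal.finite_const_le_of_tsum_ne_top hω.ne one_ne_zero
  refine this.subset fun k hk => ?_
  simp only [Set.mem_ofPred_eq] at hk ⊢
  simp [hk]

end IsPoissonPointProcess

/-- The events that depend only on the numbers of points in subsets of `R`. -/
noncomputable abbrev countEvents (z : ℕ → Ω → E) (R : Set E) : MeasurableSpace Ω :=
  ⨆ B : {B : Set E // MeasurableSet B ∧ B ⊆ R}, MeasurableSpace.comap (pointCount z B) inferInstance

omit [MeasurableSpace Ω] in
lemma measurable_pointCount_countEvents {R B : Set E} (hB : MeasurableSet B) (hBR : B ⊆ R) :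
    Measurable[countEvents z R] (pointCount z B) :=
  measurable_iff_comap_le.2 (le_iSup (fun B : {B : Set E // MeasurableSet B ∧ B ⊆ R} =>
    MeasurableSpace.comap (pointCount z B) inferInstance) ⟨B, hB, hBR⟩)

omit [MeasurableSpace Ω] [MeasurableSpace E] in
lemma pointCount_biUnion_finset {ι : Type*} (s : Finset ι) (F : ι → Set E)
    (hd : Pairwise fun i j => Disjoint (F i) (F j)) (ω : Ω) :
    pointCount z (⋃ i ∈ s, F i) ω = ∑ i ∈ s, pointCount z (F i) ω := by
  classical
  induction s using Finset.induction_on with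
  | empty => simp [pointCount]
  | insert i s hi ih =>
    rw [Finset.sum_insert hi, ← ih, Finset.set_biUnion_insert, pointCount_union]
    exact Set.disjoint_iUnion₂_right.2 fun j hj => hd fun h => hi (h ▸ hj)

namespace IsPoissonPointProcess

variable (hz : IsPoissonPointProcess μ z m)
include hz

/-- Finitely many subsets of `R` may overlap, whereas independence is given for disjoint sets only.
They cut `R` into disjoint atoms, and each of their counts is a sum of atom counts. -/
lemma indep_iSup_finset_comap [IsProbabilityMeasure μ] {R B' : Set E} (hR : MeasurableSet R)
    (hB' : MeasurableSet B') (hd : Disjoint R B')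
    (s : Finset {B : Set E // MeasurableSet B ∧ B ⊆ R}) :
    Indep (⨆ B ∈ s, MeasurableSpace.comap (pointCount z B) inferInstance)
      (MeasurableSpace.comap (pointCount z B') inferInstance) μ := by
  classical
  -- `some c` is the atom of `R` with membership pattern `c`, and `none` is `B'`.
  let F : Option (s → Bool) → Set E := fun o =>
    o.elim B' fun c => {x | x ∈ R ∧ ∀ i : s, c i = decide (x ∈ i.1.1)}
  have hFR : ∀ c, F (some c) ⊆ R := fun c x hx => hx.1
  have hF : ∀ o, MeasurableSet (F o) := by
    rintro (_ | c)
    · exact hB'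
    · have : F (some c) = R ∩ ⋂ i : s, {x | c i = decide (x ∈ i.1.1)} := by
        ext x
        simp [F]
      rw [this]
      refine hR.inter (MeasurableSet.iInter fun i => ?_)
      cases hc : c i
      · have : {x | false = decide (x ∈ i.1.1)} = i.1.1ᶜ := by ext x; simp
        rw [this]
        exact i.1.2.1.compl
      · have : {x | true = decide (x ∈ i.1.1)} = i.1.1 := by ext x; simp
        rw [this]
        exact i.1.2.1
  have hdF : Pairwise fun o o' => Disjoint (F o) (F o') := by
    rintro (_ | c) (_ | c') hne
    · exact absurd rfl hne
    · exact (hd.mono_left (hFR c')).symm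
    · exact hd.mono_left (hFR c)
    · refine Set.disjoint_left.2 fun x hx hx' => hne ?_
      congr 1
      funext i
      rw [hx.2 i, hx'.2 i]
  have hind := hz.iIndepFun_pointCount F hF hdF
  have h2 := hind.indepFun_finset {none}ᶜ {none} disjoint_compl_left
    (fun o => measurable_pointCount hz.measurable_point (hF o))
  rw [IndepFun_iff_Indep] at h2
  refine indep_of_indep_of_le_left (indep_of_indep_of_le_right h2 ?_) (iSup₂_le fun B hB => ?_)
  · rw [← measurable_iff_comap_le]
    have : Measurable fun f : (({none} : Finset (Option (s → Bool))) → ENNReal) =>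
      f ⟨none, by simp⟩ := measurable_pi_apply _
    exact this.comp (comap_measurable _)
  · rw [← measurable_iff_comap_le]
    have hU : (B : Set E) = ⋃ c ∈ (Finset.univ.filter fun c : s → Bool => c ⟨B, hB⟩ = true),
        F (some c) := by
      ext x
      simp only [Finset.mem_filter, Finset.mem_univ, true_and, Set.mem_iUnion, exists_prop]
      constructor
      · intro hx
        exact ⟨fun i => decide (x ∈ i.1.1), by simpa using hx, B.2.2 hx, fun i => rfl⟩
      · rintro ⟨c, hc, hx⟩
        have := hx.2 ⟨B, hB⟩
        rw [hc] at this
        simpa using this.symm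
    have hsum : pointCount z (B : Set E) = fun ω =>
        ∑ c ∈ (Finset.univ.filter fun c : s → Bool => c ⟨B, hB⟩ = true),
          pointCount z (F (some c)) ω := by
      funext ω
      conv_lhs => rw [hU]
      exact pointCount_biUnion_finset _ (fun c => F (some c))
        (fun c c' h => hdF (by simpa using h)) ω
    rw [hsum]
    refine Finset.measurable_sum _ fun c _ => ?_
    have : Measurable fun f : (({none}ᶜ : Finset (Option (s → Bool))) → ENNReal) =>
      f ⟨some c, by simp⟩ := measurable_pi_apply _
    exact this.comp (comap_measurable _)

/-- The count events of `R` are the directed supremum of those of finite families of subsets, and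
independence passes to such suprema. -/
lemma indep_countEvents [IsProbabilityMeasure μ] {R B' : Set E} (hR : MeasurableSet R)
    (hB' : MeasurableSet B') (hd : Disjoint R B') :
    Indep (countEvents z R) (MeasurableSpace.comap (pointCount z B') inferInstance) μ := by
  classical
  have h : countEvents z R = ⨆ s : Finset {B : Set E // MeasurableSet B ∧ B ⊆ R},
      ⨆ B ∈ s, MeasurableSpace.comap (pointCount z B) inferInstance := by
    rw [countEvents, iSup_eq_iSup_finset]
  rw [h]
  refine indep_iSup_of_directed_le (fun s => hz.indep_iSup_finset_comap hR hB' hd s)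
    (fun s => iSup₂_le fun B _ => (measurable_pointCount hz.measurable_point B.2.1).comap_le)
    (measurable_pointCount hz.measurable_point hB').comap_le ?_
  refine Monotone.directed_le fun s t hst => ?_
  exact biSup_mono fun B hB => hst hB

end IsPoissonPointProcess

end PointSums

/-- Independence turns the weighted mean count into `(∫ w) * m B`, which is again a measure in `B`.
-/
lemma IsPoissonPointProcess.lintegral_mul_tsum_comp_of_indep {Ω E : Type*}
    {𝓕 mΩ : MeasurableSpace Ω} [MeasurableSpace E] {μ : Measure Ω} {z : ℕ → Ω → E} {m : Measure E}
    (hz : IsPoissonPointProcess μ z m) (hle : 𝓕 ≤ mΩ)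
    {K : Set E} (hK : MeasurableSet K) (hmK : m K < ⊤)
    (hind : ∀ B, MeasurableSet B → B ⊆ K →
      Indep 𝓕 (MeasurableSpace.comap (pointCount z B) inferInstance) μ)
    {w : Ω → ENNReal} (hw : Measurable[𝓕] w)
    {g : E → ENNReal} (hg : Measurable g) (hgK : ∀ x, x ∉ K → g x = 0) :
    ∫⁻ ω, w ω * ∑' k, g (z k ω) ∂μ = (∫⁻ ω, w ω ∂μ) * ∫⁻ x, g x ∂m := by
  have := lintegral_mul_tsum_comp (w := w) (μ := μ) hz.measurable_point (hw.mono hle le_rfl) hK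
    (ρ := (∫⁻ ω, w ω ∂μ) • m) (fun B hB hBK => by
      rw [lintegral_mul_eq_lintegral_mul_lintegral_of_independent_measurableSpace hle
        (measurable_pointCount hz.measurable_point hB).comap_le
        (hind B hB hBK) hw (comap_measurable _),
        hz.lintegral_pointCount hB ((measure_mono hBK).trans_lt hmK)]
      rfl) hg hgK
  rw [this, lintegral_smul_measure]
  rfl

/-! ### The law of a sum over the points of a Poisson point process -/

lemma toReal_pointCount {Ω E : Type*} {z : ℕ → Ω → E} {B : Set E} {ω : Ω} (s : Finset ℕ)
    (hs : ∀ k, z k ω ∈ B → k ∈ s) :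
    (pointCount z B ω).toReal = ∑ k ∈ s, B.indicator (fun _ => (1 : ℝ)) (z k ω) := by
  unfold pointCount
  rw [tsum_eq_sum (s := s) fun k hk => Set.indicator_of_notMem (fun h => hk (hs k h)) _,
    ENNReal.toReal_sum fun k _ => by by_cases h : z k ω ∈ B <;> simp [h]]
  refine Finset.sum_congr rfl fun k _ => ?_
  by_cases h : z k ω ∈ B <;> simp [h]

lemma sum_indicator_floor_eq (n : ℕ) {y : ℝ} (hy : y ∈ Set.Icc (0 : ℝ) 1) :
    ∑ j : Fin n, ((j : ℝ) + 1) / n * {x : ℝ | ⌊x * n⌋₊ = j + 1}.indicator (fun _ => (1 : ℝ)) y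
      = (⌊y * n⌋₊ : ℝ) / n := by
  rcases Nat.eq_zero_or_pos ⌊y * n⌋₊ with h | h
  · simp [h]
  · have hle : ⌊y * n⌋₊ ≤ n := by
      refine Nat.floor_le_of_le ?_
      nlinarith [hy.2, Nat.cast_nonneg (α := ℝ) n]
    -- Level 0 is left out because it contributes nothing, so the index of a level is one less than
    -- its value.
    rw [Finset.sum_eq_single (⟨⌊y * n⌋₊ - 1, by lia⟩ : Fin n)]
    · have h1 : ⌊y * n⌋₊ = ⌊y * n⌋₊ - 1 + 1 := by lia
      rw [Set.indicator_of_mem (by simpa using h1), mul_one]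
      congr 1
      rw [← Nat.cast_add_one, ← h1]
    · intro j _ hj
      rw [Set.indicator_of_notMem, mul_zero]
      intro hmem
      apply hj
      ext
      simp only [Set.mem_ofPred_eq] at hmem
      simp only [hmem]
      lia
    · simp

section LawOfSum

variable {Ω E : Type*} [MeasurableSpace Ω] [MeasurableSpace E] {μ : Measure Ω} {z : ℕ → Ω → E}
  {m : Measure E}

/-- The sum of `f` over the points, with the values of `f` rounded down to multiples of `1 / n`. -/
noncomputable def roundedSum (z : ℕ → Ω → E) (f : E → ℝ) (n : ℕ) (ω : Ω) : ℝ :=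
  ∑ j : Fin n, ((j : ℝ) + 1) / n * (pointCount z (f ⁻¹' {x : ℝ | ⌊x * n⌋₊ = j + 1}) ω).toReal

lemma measurableSet_floor_mul_eq (n j : ℕ) : MeasurableSet {x : ℝ | ⌊x * n⌋₊ = j + 1} :=
  (Nat.measurable_floor.comp (measurable_id.mul_const (n : ℝ))) (measurableSet_singleton (j + 1))

lemma measurable_roundedSum (hz : ∀ k, Measurable (z k)) {f : E → ℝ} (hf : Measurable f) (n : ℕ) :
    Measurable (roundedSum z f n) := by
  unfold roundedSum
  refine Finset.measurable_sum _ fun j _ => ?_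
  exact (measurable_pointCount hz (hf (measurableSet_floor_mul_eq n j))).ennreal_toReal.const_mul _

lemma measurable_tsum_comp (hz : ∀ k, Measurable (z k)) {f : E → ℝ} (hf : Measurable f) :
    Measurable fun ω => ∑' k, f (z k ω) :=
  Measurable.tsum fun k => hf.comp (hz k)

namespace IsPoissonPointProcess

variable (hz : IsPoissonPointProcess μ z m)
include hz

/-- Almost surely only finitely many points lie in `K`, and the rounding error at each of them
vanishes. The rounded sums depend on finitely many counts only, which makes their laws computable.
-/
lemma tendsto_roundedSum {f : E → ℝ} (hf : ∀ x, f x ∈ Set.Icc (0 : ℝ) 1) {K : Set E}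
    (hK : MeasurableSet K) (hmK : m K < ⊤) (hfK : ∀ x, x ∉ K → f x = 0) :
    ∀ᵐ ω ∂μ, Tendsto (fun n => roundedSum z f n ω) atTop (𝓝 (∑' k, f (z k ω))) := by
  filter_upwards [hz.ae_finite_mem hK hmK] with ω hω
  have hs : ∀ n : ℕ, roundedSum z f n ω = ∑ k ∈ hω.toFinset, (⌊f (z k ω) * n⌋₊ : ℝ) / n := by
    intro n
    unfold roundedSum
    simp_rw [← sum_indicator_floor_eq n (hf _)]
    rw [Finset.sum_comm]
    refine Finset.sum_congr rfl fun j _ => ?_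
    rw [toReal_pointCount hω.toFinset, Finset.mul_sum]
    · rfl
    · intro k hk
      rw [Set.Finite.mem_toFinset]
      by_contra hkK
      have := hfK _ hkK
      simp [this] at hk
  simp_rw [hs]
  rw [tsum_eq_sum (s := hω.toFinset) fun k hk => hfK _ fun h => hk (by simpa using h)]
  exact tendsto_finsetSum _ fun k _ =>
    (tendsto_nat_floor_mul_div_atTop (hf _).1).comp tendsto_natCast_atTop_atTop

/-- The level sets are disjoint, avoid the value 0 and hence have finite intensity. So their counts
are independent Poisson variables with parameters that agree for `f` and `g`. -/
lemma map_roundedSum_eq [IsProbabilityMeasure μ] {f g : E → ℝ} (hf : Measurable f)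
    (hg : Measurable g) {K : Set E} (hmK : m K < ⊤) (hfK : ∀ x, x ∉ K → f x = 0)
    (h : ∀ C : Set ℝ, MeasurableSet C → (0 : ℝ) ∉ C → m (f ⁻¹' C) = m (g ⁻¹' C)) (n : ℕ) :
    μ.map (roundedSum z f n) = μ.map (roundedSum z g n) := by
  let C : Fin n → Set ℝ := fun j => {x : ℝ | ⌊x * n⌋₊ = j + 1}
  have hC : ∀ j, MeasurableSet (C j) := fun j => measurableSet_floor_mul_eq n j
  have h0 : ∀ j, (0 : ℝ) ∉ C j := fun j => by simp [C]
  have hd : ∀ u : E → ℝ, Pairwise fun i j => Disjoint (u ⁻¹' C i) (u ⁻¹' C j) := by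
    intro u i j hij
    refine Set.disjoint_left.2 fun x hx hx' => hij ?_
    ext
    have h1 : ⌊u x * n⌋₊ = i + 1 := hx
    have h2 : ⌊u x * n⌋₊ = j + 1 := hx'
    lia
  have hfin : ∀ j, m (f ⁻¹' C j) < ⊤ := fun j => by
    refine (measure_mono fun x hx => ?_).trans_lt hmK
    by_contra hxK
    exact h0 j (hfK x hxK ▸ hx)
  have hm : ∀ {u : E → ℝ}, Measurable u → ∀ j, AEMeasurable (pointCount z (u ⁻¹' C j)) μ :=
    fun hu j => (measurable_pointCount hz.measurable_point (hu (hC j))).aemeasurable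
  have hpi : ∀ {u : E → ℝ}, Measurable u → (∀ j, m (u ⁻¹' C j) < ⊤) →
      μ.map (fun ω j => pointCount z (u ⁻¹' C j) ω) = Measure.pi fun j =>
        (poissonMeasure (m (u ⁻¹' C j)).toNNReal).map (fun n : ℕ => (n : ENNReal)) := by
    intro u hu hufin
    rw [(iIndepFun_iff_map_fun_eq_pi_map (hm hu)).1
      (hz.iIndepFun_pointCount _ (fun j => hu (hC j)) (hd u))]
    congr 1
    funext j
    exact (hz.hasLaw_count _ (hu (hC j)) (hufin j)).map_eq
  have hgfin : ∀ j, m (g ⁻¹' C j) < ⊤ := fun j => h _ (hC j) (h0 j) ▸ hfin j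
  have hlaw : μ.map (fun ω j => pointCount z (f ⁻¹' C j) ω)
      = μ.map (fun ω j => pointCount z (g ⁻¹' C j) ω) := by
    rw [hpi hf hfin, hpi hg hgfin]
    congr 1
    funext j
    rw [h _ (hC j) (h0 j)]
  let Φ : (Fin n → ENNReal) → ℝ := fun v => ∑ j : Fin n, ((j : ℝ) + 1) / n * (v j).toReal
  have hΦ : Measurable Φ := Finset.measurable_sum _ fun j _ =>
    (measurable_pi_apply j).ennreal_toReal.const_mul _
  have hmap : ∀ {u : E → ℝ}, Measurable u → μ.map (roundedSum z u n)
      = (μ.map (fun ω j => pointCount z (u ⁻¹' C j) ω)).map Φ := by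
    intro u hu
    rw [Measure.map_map hΦ (measurable_pi_lambda _ fun j =>
      measurable_pointCount hz.measurable_point (hu (hC j)))]
    rfl
  rw [hmap hf, hmap hg, hlaw]

/-- The law of the sum of `f` over the points of a Poisson point process depends on `f` only through
the image of the intensity measure under `f`. -/
lemma map_tsum_comp_eq [IsProbabilityMeasure μ] {f g : E → ℝ} (hf : Measurable f)
    (hg : Measurable g) (hf01 : ∀ x, f x ∈ Set.Icc (0 : ℝ) 1) (hg01 : ∀ x, g x ∈ Set.Icc (0 : ℝ) 1)
    {K K' : Set E} (hK : MeasurableSet K) (hmK : m K < ⊤) (hfK : ∀ x, x ∉ K → f x = 0)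
    (hK' : MeasurableSet K') (hmK' : m K' < ⊤) (hgK' : ∀ x, x ∉ K' → g x = 0)
    (h : ∀ C : Set ℝ, MeasurableSet C → (0 : ℝ) ∉ C → m (f ⁻¹' C) = m (g ⁻¹' C)) :
    μ.map (fun ω => ∑' k, f (z k ω)) = μ.map (fun ω => ∑' k, g (z k ω)) := by
  have hX : ∀ {u : E → ℝ}, Measurable u → ∀ n, AEMeasurable (roundedSum z u n) μ :=
    fun hu n => (measurable_roundedSum hz.measurable_point hu n).aemeasurable
  have h1 := tendstoInDistribution_of_ae_tendsto (hX hf)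
    (measurable_tsum_comp hz.measurable_point hf).aemeasurable
    (hz.tendsto_roundedSum hf01 hK hmK hfK)
  have h2 := tendstoInDistribution_of_ae_tendsto (hX hg)
    (measurable_tsum_comp hz.measurable_point hg).aemeasurable
    (hz.tendsto_roundedSum hg01 hK' hmK' hgK')
  have hlim := h1.tendsto
  simp_rw [hz.map_roundedSum_eq hf hg hmK hfK h] at hlim
  have h_eq := tendsto_nhds_unique hlim h2.tendsto
  exact congrArg (fun p : ProbabilityMeasure ℝ => (p : Measure ℝ)) h_eq

end IsPoissonPointProcess

end LawOfSum

/-! ### Convergence of moments -/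

section Moments

variable {Ω : Type*} [MeasurableSpace Ω] {μ : Measure Ω} [IsProbabilityMeasure μ]

/-- Truncation changes `y` only if `|y| ≥ K`, and then by at most `|y| ≤ y² / K`. -/
lemma abs_sub_clamp_le (y : ℝ) {K : ℝ} (hK : 0 < K) :
    |y - max (-K) (min y K)| ≤ K⁻¹ * y ^ 2 := by
  have h0 : 0 ≤ K⁻¹ * y ^ 2 := by positivity
  have h2 : ∀ u : ℝ, 0 ≤ u → K ≤ u → u ≤ K⁻¹ * u ^ 2 := by
    intro u hu hKu
    rw [inv_mul_eq_div, le_div_iff₀ hK]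
    nlinarith
  rcases le_total y K with h | h
  · rw [min_eq_left h]
    rcases le_total (-K) y with h' | h'
    · rw [max_eq_right h']
      simpa using h0
    · rw [max_eq_left h', abs_of_nonpos (by linarith)]
      have := h2 (-y) (by linarith) (by linarith)
      rw [neg_sq] at this
      linarith
  · rw [min_eq_right h, max_eq_right (by linarith), abs_of_nonneg (by linarith)]
    linarith [h2 y (by linarith) h]

lemma tendsto_integral_clamp {α : Type*} [MeasurableSpace α] {π : Measure α}
    {φ : α → ℝ} (hφ : Integrable φ π) :
    Tendsto (fun n : ℕ => ∫ x, max (-(n : ℝ)) (min (φ x) n) ∂π) atTop (𝓝 (∫ x, φ x ∂π)) := by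
  refine tendsto_integral_of_dominated_convergence (fun x => |φ x|) (fun n => ?_) hφ.abs
    (fun n => ?_) ?_
  · exact (continuous_const.max (continuous_id.min continuous_const)).comp_aestronglyMeasurable
      hφ.aestronglyMeasurable
  · refine Eventually.of_forall fun x => ?_
    have hn : (0 : ℝ) ≤ n := n.cast_nonneg
    rw [Real.norm_eq_abs, abs_le]
    constructor
    · refine le_max_of_le_right (le_min (neg_abs_le _) ?_)
      linarith [abs_nonneg (φ x)]
    · exact max_le (by linarith [abs_nonneg (φ x)]) (min_le_of_left_le (le_abs_self _))
  · refine Eventually.of_forall fun x => ?_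
    refine tendsto_const_nhds.congr' ?_
    filter_upwards [eventually_ge_atTop ⌈|φ x|⌉₊] with n hn
    have h1 : |φ x| ≤ n := (Nat.le_ceil _).trans (by exact_mod_cast hn)
    rw [min_eq_left ((le_abs_self _).trans h1), max_eq_right (by linarith [neg_abs_le (φ x)])]

/-- Bounded second moments give uniform integrability: truncating `φ` at level `n` costs at most
`|C| / n` uniformly in `i`, and the truncation is a bounded continuous test function. -/
lemma MeasureTheory.TendstoInDistribution.tendsto_integral_of_sq_bounded {ι : Type*} {l : Filter ι}
    {X : ι → Ω → ℝ} {π : Measure ℝ} [IsProbabilityMeasure π]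
    (h : TendstoInDistribution X l (id : ℝ → ℝ) (fun _ => μ) π) {φ : ℝ → ℝ} (hφ : Continuous φ)
    (hφπ : Integrable φ π) {C : ℝ} (hint : ∀ i, Integrable (fun ω => φ (X i ω) ^ 2) μ)
    (hC : ∀ i, ∫ ω, φ (X i ω) ^ 2 ∂μ ≤ C) :
    Tendsto (fun i => ∫ ω, φ (X i ω) ∂μ) l (𝓝 (∫ x, φ x ∂π)) := by
  have hC' : ∀ i, ∫ ω, φ (X i ω) ^ 2 ∂μ ≤ |C| := fun i => (hC i).trans (le_abs_self C)
  rw [Metric.tendsto_nhds]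
  intro ε hε
  obtain ⟨n, hn1, hn2, hn0⟩ : ∃ n : ℕ,
      dist (∫ x, max (-(n : ℝ)) (min (φ x) n) ∂π) (∫ x, φ x ∂π) < ε / 3 ∧
        (n : ℝ)⁻¹ * |C| < ε / 3 ∧ 0 < n := by
    have h1 := (Metric.tendsto_nhds.1 (tendsto_integral_clamp hφπ)) (ε / 3) (by linarith)
    have h2 : Tendsto (fun n : ℕ => (n : ℝ)⁻¹ * |C|) atTop (𝓝 (0 * |C|)) :=
      (tendsto_inv_atTop_nhds_zero_nat (𝕜 := ℝ)).mul_const _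
    rw [zero_mul] at h2
    exact (h1.and ((h2.eventually_lt_const (show 0 < ε / 3 by linarith)).and (eventually_gt_atTop 0))).exists
  have hn : (0 : ℝ) < n := by exact_mod_cast hn0
  let ψ : BoundedContinuousFunction ℝ ℝ := BoundedContinuousFunction.ofNormedAddCommGroup
    (fun x => max (-(n : ℝ)) (min (φ x) n)) (by fun_prop) n (fun x => by
      rw [Real.norm_eq_abs, abs_le]
      exact ⟨le_max_left _ _, max_le (by linarith) (min_le_right _ _)⟩)
  have hψ := ProbabilityMeasure.tendsto_iff_forall_integral_tendsto.1 h.tendsto ψ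
  simp only [ProbabilityMeasure.coe_mk, Measure.map_id] at hψ
  filter_upwards [(Metric.tendsto_nhds.1 hψ) (ε / 3) (by linarith)] with i hi
  rw [integral_map (h.forall_aemeasurable i) ψ.continuous.aestronglyMeasurable] at hi
  have hXm : AEStronglyMeasurable (fun ω => φ (X i ω)) μ :=
    hφ.comp_aestronglyMeasurable (h.forall_aemeasurable i).aestronglyMeasurable
  have hXint : Integrable (fun ω => φ (X i ω)) μ :=
    ((memLp_two_iff_integrable_sq hXm).2 (hint i)).integrable one_le_two
  have hψint : Integrable (fun ω => ψ (X i ω)) μ :=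
    Integrable.of_bound (ψ.continuous.comp_aestronglyMeasurable
      (h.forall_aemeasurable i).aestronglyMeasurable) ‖ψ‖
      (Eventually.of_forall fun ω => ψ.norm_coe_le_norm _)
  have h3 : dist (∫ ω, φ (X i ω) ∂μ) (∫ ω, ψ (X i ω) ∂μ) ≤ (n : ℝ)⁻¹ * |C| := by
    rw [Real.dist_eq, ← integral_sub hXint hψint]
    refine (abs_integral_le_integral_abs).trans ?_
    refine (integral_mono (hXint.sub hψint).abs ((hint i).const_mul (n : ℝ)⁻¹)
      fun ω => abs_sub_clamp_le _ hn).trans ?_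
    rw [integral_const_mul]
    exact mul_le_mul_of_nonneg_left (hC' i) (by positivity)
  have h4 : dist (∫ x, ψ x ∂π) (∫ x, φ x ∂π) < ε / 3 := hn1
  calc dist (∫ ω, φ (X i ω) ∂μ) (∫ x, φ x ∂π)
      ≤ dist (∫ ω, φ (X i ω) ∂μ) (∫ ω, ψ (X i ω) ∂μ) + dist (∫ ω, ψ (X i ω) ∂μ) (∫ x, ψ x ∂π)
        + dist (∫ x, ψ x ∂π) (∫ x, φ x ∂π) := dist_triangle4 _ _ _ _
    _ < ε := by linarith

/-- Convergence in law alone does not carry variances to the limit. The fourth moment bound controls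
the squares of both `x` and `x²`, so the first two moments converge. -/
lemma HasStationaryVariance.tendsto_variance {P : ℝ → Ω → ℝ} {v : ℝ}
    (h : HasStationaryVariance μ P v) {C : ℝ} (hint : ∀ t, Integrable (fun ω => P t ω ^ 4) μ)
    (hC : ∀ t, ∫ ω, P t ω ^ 4 ∂μ ≤ C) :
    Tendsto (fun t => Var[P t; μ]) atTop (𝓝 v) := by
  obtain ⟨π, _, hd, hLp, hv⟩ := h
  have hm : ∀ t, AEStronglyMeasurable (P t) μ := fun t =>
    (hd.forall_aemeasurable t).aestronglyMeasurable
  have h4 : ∀ t, Integrable (fun ω => (P t ω ^ 2) ^ 2) μ := fun t => by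
    refine (hint t).congr (Eventually.of_forall fun ω => ?_)
    ring
  have hsqint : ∀ t, Integrable (fun ω => P t ω ^ 2) μ := fun t =>
    ((memLp_two_iff_integrable_sq ((hm t).pow 2)).2 (h4 t)).integrable one_le_two
  have hLpt : ∀ t, MemLp (P t) 2 μ := fun t => (memLp_two_iff_integrable_sq (hm t)).2 (hsqint t)
  have h2 : ∀ t, ∫ ω, P t ω ^ 2 ∂μ ≤ 1 + C := fun t => by
    have : ∫ ω, P t ω ^ 2 ∂μ ≤ ∫ ω, (1 + P t ω ^ 4) ∂μ := by
      refine integral_mono (hsqint t) ((integrable_const _).add (hint t)) fun ω => ?_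
      nlinarith [sq_nonneg (P t ω ^ 2 - 1)]
    rw [integral_add (integrable_const _) (hint t)] at this
    simp only [integral_const, probReal_univ, smul_eq_mul, mul_one] at this
    linarith [hC t]
  have t1 := hd.tendsto_integral_of_sq_bounded continuous_id (hLp.integrable one_le_two) hsqint h2
  have t2 := hd.tendsto_integral_of_sq_bounded (continuous_pow 2) hLp.integrable_sq h4
    (C := C) (fun t => by
      refine le_of_eq_of_le (integral_congr_ae (Eventually.of_forall fun ω => ?_)) (hC t)
      ring)
  rw [← hv, variance_eq_sub hLp]
  refine (t2.sub (t1.pow 2)).congr fun t => ?_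
  rw [variance_eq_sub (hLpt t)]
  rfl

end Moments

/-! ### Long-run averages -/

section LongRun

lemma integral_le_of_le_const {g : ℝ → ℝ} {K : ℝ} (h0 : ∀ t, 0 ≤ g t) (hK : ∀ t, g t ≤ K)
    (hg : Measurable g) {a b : ℝ} (hab : a ≤ b) :
    IntervalIntegrable g volume a b ∧ ∫ t in a..b, g t ≤ (b - a) * K := by
  have hint : IntervalIntegrable g volume a b := by
    rw [intervalIntegrable_iff_integrableOn_Ioc_of_le hab]
    refine Integrable.of_bound hg.aestronglyMeasurable K (Eventually.of_forall fun t => ?_)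
    rw [Real.norm_eq_abs, abs_of_nonneg (h0 t)]
    exact hK t
  refine ⟨hint, ?_⟩
  have := intervalIntegral.integral_mono_on hab hint (intervalIntegrable_const (c := K))
    fun t _ => hK t
  simpa using this

lemma liminf_average_le_of_tendsto {g : ℝ → ℝ} {K v : ℝ} (h0 : ∀ t, 0 ≤ g t) (hK : ∀ t, g t ≤ K)
    (hg : Measurable g) (hv : Tendsto g atTop (𝓝 v)) :
    liminf (fun T : ℝ => (1 / T) * ∫ t in (0 : ℝ)..T, g t) atTop ≤ v := by
  refine le_of_forall_pos_le_add fun ε hε => ?_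
  have hv0 : 0 ≤ v := ge_of_tendsto' hv h0
  have hK0 : 0 ≤ K := (h0 0).trans (hK 0)
  obtain ⟨T₀, hT₀⟩ := eventually_atTop.1 (hv.eventually_le_const (show v < v + ε / 2 by linarith))
  set S := max T₀ 0 with hS
  have hS0 : 0 ≤ S := le_max_right _ _
  -- For `T ≥ S` the piece up to `S` contributes at most `S * K / T`, eventually below `ε / 2`, and
  -- the rest at most `v + ε / 2`. The lower bound 0 is needed for a real-valued `liminf` to be
  -- meaningful.
  refine liminf_le_of_frequently_le (Eventually.frequently ?_)
    ⟨0, eventually_map.2 ((eventually_ge_atTop 0).mono fun T hT => ?_)⟩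
  · filter_upwards [eventually_ge_atTop S, eventually_gt_atTop 0,
      eventually_ge_atTop (S * K / (ε / 2))] with T hTS hT0 hT
    have h1 := integral_le_of_le_const h0 hK hg hS0
    have i2 := (integral_le_of_le_const h0 hK hg hTS).1
    have h2 := intervalIntegral.integral_mono_on hTS i2
      (intervalIntegrable_const (c := v + ε / 2)) fun t ht => hT₀ t ((le_max_left _ _).trans ht.1)
    rw [intervalIntegral.integral_const, smul_eq_mul] at h2
    rw [← intervalIntegral.integral_add_adjacent_intervals h1.1 i2, one_div,
      inv_mul_le_iff₀ hT0]
    have h3 := h1.2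
    rw [div_le_iff₀ (by linarith)] at hT
    nlinarith
  · exact mul_nonneg (by positivity) (intervalIntegral.integral_nonneg hT fun t _ => h0 t)

/-- After division by `T` the terms of order `1 / T` vanish, leaving `L ≥ lam * (q - lam * D)` for
every `lam > 0`. The optimal `lam` is encoded in a discriminant, which also covers `D = 0`. -/
lemma sq_le_mul_liminf_average {g : ℝ → ℝ} {K q D : ℝ} (h0 : ∀ t, 0 ≤ g t) (hK : ∀ t, g t ≤ K)
    (hg : Measurable g) (hq : 0 ≤ q) (hD : 0 ≤ D)
    (h : ∀ lam > 0, ∀ T > 0, T * q ≤ D + lam * D * T + lam⁻¹ * ∫ t in (0 : ℝ)..T, g t) :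
    0 ≤ liminf (fun T : ℝ => (1 / T) * ∫ t in (0 : ℝ)..T, g t) atTop ∧
    q ^ 2 ≤ 4 * D * liminf (fun T : ℝ => (1 / T) * ∫ t in (0 : ℝ)..T, g t) atTop := by
  set L := liminf (fun T : ℝ => (1 / T) * ∫ t in (0 : ℝ)..T, g t) atTop with hL
  have hcob : IsCoboundedUnder (· ≥ ·) atTop
      (fun T : ℝ => (1 / T) * ∫ t in (0 : ℝ)..T, g t) := by
    refine IsBoundedUnder.isCoboundedUnder_ge
      ⟨K, eventually_map.2 ((eventually_gt_atTop 0).mono fun T hT => ?_)⟩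
    have := (integral_le_of_le_const h0 hK hg hT.le).2
    change (1 / T) * ∫ t in (0 : ℝ)..T, g t ≤ K
    rw [one_div, inv_mul_le_iff₀ hT]
    linarith
  have hL0 : 0 ≤ L := le_liminf_of_le hcob ((eventually_ge_atTop 0).mono fun T hT =>
    mul_nonneg (by positivity) (intervalIntegral.integral_nonneg hT fun t _ => h0 t))
  have key : ∀ lam > 0, lam * (q - lam * D) ≤ L := by
    intro lam hlam
    refine le_of_forall_pos_le_add fun ε hε => ?_
    rw [← sub_le_iff_le_add]
    refine le_liminf_of_le hcob ?_
    filter_upwards [eventually_gt_atTop 0, eventually_ge_atTop (lam * D / ε)] with T hT hT'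
    have h1 := h lam hlam T hT
    rw [div_le_iff₀ hε] at hT'
    rw [one_div, ← div_eq_inv_mul, le_div_iff₀ hT]
    have h2 := mul_le_mul_of_nonneg_left h1 hlam.le
    have h3 : lam * (D + lam * D * T + lam⁻¹ * ∫ t in (0 : ℝ)..T, g t)
        = lam * D + lam * (lam * D * T) + ∫ t in (0 : ℝ)..T, g t := by
      field_simp
    rw [h3] at h2
    nlinarith
  refine ⟨hL0, ?_⟩
  -- For `x ≤ 0` all three terms are nonnegative, so the quadratic is nonnegative on the whole line.
  have hquad : ∀ x : ℝ, 0 ≤ D * (x * x) + (-q) * x + L := by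
    intro x
    rcases le_or_gt x 0 with hx | hx
    · have : 0 ≤ q * (-x) := mul_nonneg hq (by linarith)
      nlinarith [mul_nonneg hD (mul_self_nonneg x)]
    · nlinarith [key x hx]
  have := discrim_le_zero hquad
  unfold discrim at this
  linarith

end LongRun

/-! ### The energy identity -/

section Energy

/-- Integration by parts for the primitive of `c`. As `c` need not be continuous, the primitive is
only absolutely continuous, with derivative `c` almost everywhere. -/
lemma sq_intervalIntegral_eq {c : ℝ → ℝ} {T : ℝ} (hc : IntervalIntegrable c volume 0 T) :
    (∫ s in (0 : ℝ)..T, c s) ^ 2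
      = 2 * ∫ s in (0 : ℝ)..T, (∫ u in (0 : ℝ)..s, c u) * c s := by
  have hac := hc.absolutelyContinuousOnInterval_intervalIntegral (c := 0) (by simp)
  have h := hac.integral_deriv_mul_eq_sub hac
  rw [intervalIntegral.integral_same, mul_zero, sub_zero, ← sq] at h
  rw [← h, ← intervalIntegral.integral_const_mul]
  refine intervalIntegral.integral_congr_ae ?_
  filter_upwards [hc.ae_hasDerivAt_integral] with x hx hxT
  rw [(hx (Set.uIoc_subset_uIcc hxT) 0 (by simp)).deriv]
  ring

variable {Ω : Type*} [MeasurableSpace Ω] {μ : Measure Ω} [IsProbabilityMeasure μ]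

/-- Of the martingale property of `M` only the orthogonality `hMc` is used. The bound `G` dominates
`c` and its running integral, which justifies Fubini. -/
lemma integral_sq_le_of_energy {c M : ℝ → Ω → ℝ} {G : Ω → ℝ} {T D lam : ℝ} (hT : 0 ≤ T)
    (hlam : 0 < lam) (hc : Measurable fun p : ℝ × Ω => c p.1 p.2) (hG : MemLp G 2 μ)
    (hcG : ∀ᵐ ω ∂μ, ∀ s ∈ Set.Icc 0 T, |c s ω| ≤ G ω) (hM : ∀ s, MemLp (M s) 2 μ)
    (hMc : ∀ s ∈ Set.Icc 0 T, ∫ ω, M T ω * c s ω ∂μ = ∫ ω, M s ω * c s ω ∂μ)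
    (hD : ∀ s ∈ Set.Icc 0 T, ∫ ω, (M s ω - ∫ u in (0 : ℝ)..s, c u ω) ^ 2 ∂μ ≤ D) :
    ∫ ω, M T ω ^ 2 ∂μ
      ≤ D + lam * D * T + lam⁻¹ * ∫ s in (0 : ℝ)..T, ∫ ω, c s ω ^ 2 ∂μ := by
  set ν := (volume : Measure ℝ).restrict (Set.Ioc 0 T) with hν
  set Y : ℝ → Ω → ℝ := fun s ω => ∫ u in (0 : ℝ)..s, c u ω with hY
  have hcs : ∀ s, Measurable (c s) := fun s => hc.comp measurable_prodMk_left
  have hcω : ∀ ω, Measurable fun s => c s ω := fun ω => hc.comp measurable_prodMk_right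
  have hint : ∀ᵐ ω ∂μ, ∀ s ∈ Set.Icc 0 T, IntervalIntegrable (fun u => c u ω) volume 0 s ∧
      |Y s ω| ≤ T * G ω := by
    filter_upwards [hcG] with ω hω s hs
    have hb : ∀ u ∈ Set.Ioc 0 s, ‖c u ω‖ ≤ G ω := fun u hu =>
      hω u ⟨hu.1.le, hu.2.trans hs.2⟩
    have hG0 : 0 ≤ G ω := (abs_nonneg _).trans (hω s hs)
    constructor
    · rw [intervalIntegrable_iff_integrableOn_Ioc_of_le hs.1]
      exact Integrable.of_bound (hcω ω).aestronglyMeasurable (G ω)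
        ((ae_restrict_iff' measurableSet_Ioc).2 (Eventually.of_forall hb))
    · have := intervalIntegral.norm_integral_le_of_norm_le_const (a := 0) (b := s)
        (f := fun u => c u ω) (C := G ω) (by rwa [Set.uIoc_of_le hs.1])
      rw [sub_zero, abs_of_nonneg hs.1, Real.norm_eq_abs] at this
      nlinarith [hs.2]
  -- joint measurability of the running integral on `[0, T]`
  set Y' : ℝ × Ω → ℝ := fun p => ∫ u, (Set.Ioc 0 p.1).indicator (fun u => c u p.2) u with hY'
  have hY'm : StronglyMeasurable Y' := by
    have : Measurable fun q : (ℝ × Ω) × ℝ =>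
        (Set.Ioc 0 q.1.1).indicator (fun u => c u q.1.2) q.2 := by
      have hset : MeasurableSet {q : (ℝ × Ω) × ℝ | q.2 ∈ Set.Ioc 0 q.1.1} :=
        (measurableSet_lt measurable_const measurable_snd).inter
          (measurableSet_le measurable_snd measurable_fst.fst)
      exact (hc.comp (measurable_snd.prodMk measurable_fst.snd : Measurable
        fun q : (ℝ × Ω) × ℝ => (q.2, q.1.2))).indicator hset
    exact this.stronglyMeasurable.integral_prod_right'
  have hYY' : ∀ s, 0 ≤ s → ∀ ω, Y s ω = Y' (s, ω) := by
    intro s hs ω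
    simp only [hY, hY']
    rw [intervalIntegral.integral_of_le hs, integral_indicator measurableSet_Ioc]
  have hYm : ∀ s, 0 ≤ s → AEStronglyMeasurable (Y s) μ := fun s hs => by
    have := (hY'm.comp_measurable (measurable_prodMk_left (x := s))).aestronglyMeasurable (μ := μ)
    exact this.congr (Eventually.of_forall fun ω => (hYY' s hs ω).symm)
  have hYLp : ∀ s ∈ Set.Icc 0 T, MemLp (Y s) 2 μ := fun s hs =>
    (hG.const_mul T).of_le (hYm s hs.1) (by
      filter_upwards [hint] with ω hω
      rw [Real.norm_eq_abs]
      exact (hω s hs).2.trans (le_abs_self _))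
  have hcLp : ∀ s ∈ Set.Icc 0 T, MemLp (c s) 2 μ := fun s hs =>
    hG.of_le (hcs s).aestronglyMeasurable (by
      filter_upwards [hcG] with ω hω
      rw [Real.norm_eq_abs]
      exact (hω s hs).trans (le_abs_self _))
  -- integrability on the product space
  have hprod : ∀ {f : ℝ × Ω → ℝ} {H : Ω → ℝ}, AEStronglyMeasurable f (ν.prod μ) →
      Integrable H μ → (∀ᵐ ω ∂μ, ∀ s ∈ Set.Ioc 0 T, |f (s, ω)| ≤ H ω) →
      Integrable f (ν.prod μ) := by
    intro f H hf hH hb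
    refine (hH.comp_snd ν).mono' hf ?_
    have h1 : ∀ᵐ p ∂(ν.prod μ), ∀ s ∈ Set.Ioc 0 T, |f (s, p.2)| ≤ H p.2 :=
      Measure.quasiMeasurePreserving_snd.ae hb
    have h2 : ∀ᵐ p ∂(ν.prod μ), p.1 ∈ Set.Ioc 0 T :=
      Measure.quasiMeasurePreserving_fst.ae (ae_restrict_mem measurableSet_Ioc)
    filter_upwards [h1, h2] with p hp1 hp2
    exact hp1 p.1 hp2
  have hI : Integrable (fun p : ℝ × Ω => (M T p.2 - Y' p) * c p.1 p.2) (ν.prod μ) := by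
    refine hprod ?_ (H := fun ω => (|M T ω| + T * G ω) * G ω) ?_ ?_
    · exact ((hM T).aestronglyMeasurable.comp_snd.sub hY'm.aestronglyMeasurable).mul
        hc.aestronglyMeasurable
    · exact MemLp.integrable_mul ((hM T).abs.add (hG.const_mul T)) hG
    · filter_upwards [hcG, hint] with ω h1 h2 s hs
      have hs' : s ∈ Set.Icc 0 T := ⟨hs.1.le, hs.2⟩
      rw [abs_mul]
      refine mul_le_mul ?_ (h1 s hs') (abs_nonneg _) ?_
      · rw [← hYY' s hs'.1]
        exact (abs_sub _ _).trans (add_le_add le_rfl (h2 s hs').2)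
      · exact add_nonneg (abs_nonneg _) ((abs_nonneg _).trans (h2 s hs').2)
  have hIc : Integrable (fun p : ℝ × Ω => c p.1 p.2 ^ 2) (ν.prod μ) := by
    refine hprod (hc.pow_const 2).aestronglyMeasurable hG.integrable_sq ?_
    filter_upwards [hcG] with ω h1 s hs
    rw [abs_pow]
    exact pow_le_pow_left₀ (abs_nonneg _) (h1 s ⟨hs.1.le, hs.2⟩) 2
  -- the pathwise identity
  have hpath : ∀ᵐ ω ∂μ, (M T ω - Y T ω) ^ 2
      = M T ω ^ 2 - 2 * ∫ s, (M T ω - Y' (s, ω)) * c s ω ∂ν := by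
    filter_upwards [hint] with ω hω
    have hi := (hω T ⟨hT, le_rfl⟩).1
    have hsq := sq_intervalIntegral_eq hi
    have hYi : IntervalIntegrable (fun s => (∫ u in (0 : ℝ)..s, c u ω) * c s ω) volume 0 T :=
      hi.continuousOn_mul (hi.absolutelyContinuousOnInterval_intervalIntegral
        (c := 0) (by simp)).continuousOn
    have e1 : ∫ s, (M T ω - Y' (s, ω)) * c s ω ∂ν
        = ∫ s in (0 : ℝ)..T, (M T ω * c s ω - (∫ u in (0 : ℝ)..s, c u ω) * c s ω) := by
      rw [intervalIntegral.integral_of_le hT]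
      refine setIntegral_congr_fun measurableSet_Ioc fun s hs => ?_
      rw [← hYY' s hs.1.le ω, sub_mul]
    rw [e1, intervalIntegral.integral_sub (hi.const_mul _) hYi, intervalIntegral.integral_const_mul,
      sub_sq, mul_sub]
    have e2 : Y T ω ^ 2 = 2 * ∫ s in (0 : ℝ)..T, (∫ u in (0 : ℝ)..s, c u ω) * c s ω := hsq
    rw [e2]
    simp only [hY]
    ring
  have hE : ∫ ω, (M T ω - Y T ω) ^ 2 ∂μ
      = ∫ ω, M T ω ^ 2 ∂μ - 2 * ∫ s, ∫ ω, (M T ω - Y' (s, ω)) * c s ω ∂μ ∂ν := by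
    rw [integral_congr_ae hpath, integral_sub (hM T).integrable_sq
      (hI.integral_prod_right.const_mul 2), integral_const_mul, integral_integral_swap]
    exact hI.swap
  have hbound : ∀ s ∈ Set.Ioc 0 T, 2 * ∫ ω, (M T ω - Y' (s, ω)) * c s ω ∂μ
      ≤ lam * D + lam⁻¹ * ∫ ω, c s ω ^ 2 ∂μ := by
    intro s hs
    have hs' : s ∈ Set.Icc 0 T := ⟨hs.1.le, hs.2⟩
    have hMYs : MemLp (fun ω => M s ω - Y s ω) 2 μ := (hM s).sub (hYLp s hs')
    have hmul : ∀ {X : Ω → ℝ}, MemLp X 2 μ → Integrable (fun ω => X ω * c s ω) μ :=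
      fun hX => MemLp.integrable_mul hX (hcLp s hs')
    -- Orthogonality replaces the terminal value `M T` by `M s`; the factor is now the tracking
    -- error at time `s`, which `D` controls.
    have e1 : ∫ ω, (M T ω - Y' (s, ω)) * c s ω ∂μ = ∫ ω, (M s ω - Y s ω) * c s ω ∂μ := by
      simp_rw [← hYY' s hs'.1, sub_mul]
      rw [integral_sub (hmul (hM T)) (hmul (hYLp s hs')), hMc s hs',
        integral_sub (hmul (hM s)) (hmul (hYLp s hs'))]
    rw [e1, ← integral_const_mul]
    calc ∫ ω, 2 * ((M s ω - Y s ω) * c s ω) ∂μ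
        ≤ ∫ ω, (lam * (M s ω - Y s ω) ^ 2 + lam⁻¹ * c s ω ^ 2) ∂μ := by
          refine integral_mono ((hmul hMYs).const_mul 2)
            ((hMYs.integrable_sq.const_mul _).add ((hcLp s hs').integrable_sq.const_mul _))
            fun ω => ?_
          have h1 : lam * (M s ω - Y s ω) ^ 2 + lam⁻¹ * c s ω ^ 2
              - 2 * ((M s ω - Y s ω) * c s ω) = lam⁻¹ * (lam * (M s ω - Y s ω) - c s ω) ^ 2 := by
            field_simp
            ring
          have h2 : 0 ≤ lam⁻¹ * (lam * (M s ω - Y s ω) - c s ω) ^ 2 := by positivity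
          simp only
          linarith
      _ ≤ lam * D + lam⁻¹ * ∫ ω, c s ω ^ 2 ∂μ := by
          rw [integral_add (hMYs.integrable_sq.const_mul _)
            ((hcLp s hs').integrable_sq.const_mul _), integral_const_mul, integral_const_mul]
          have := mul_le_mul_of_nonneg_left (hD s hs') hlam.le
          linarith
  have hfinal : 2 * ∫ s, ∫ ω, (M T ω - Y' (s, ω)) * c s ω ∂μ ∂ν
      ≤ lam * D * T + lam⁻¹ * ∫ s, ∫ ω, c s ω ^ 2 ∂μ ∂ν := by
    have hcint : Integrable (fun s => ∫ ω, c s ω ^ 2 ∂μ) ν := hIc.integral_prod_left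
    rw [← integral_const_mul, ← integral_const_mul]
    calc ∫ s, 2 * ∫ ω, (M T ω - Y' (s, ω)) * c s ω ∂μ ∂ν
        ≤ ∫ s, (lam * D + lam⁻¹ * ∫ ω, c s ω ^ 2 ∂μ) ∂ν :=
          integral_mono_ae (hI.integral_prod_left.const_mul 2)
            ((integrable_const _).add (hcint.const_mul _))
            ((ae_restrict_iff' measurableSet_Ioc).2 (Eventually.of_forall hbound))
      _ = _ := by
          rw [integral_add (integrable_const _) (hcint.const_mul _)]
          simp [hν, hT, mul_comm]
  rw [intervalIntegral.integral_of_le hT]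
  have := hD T ⟨hT, le_rfl⟩
  rw [hE] at this
  linarith

end Energy

/-! ### Real-valued sums over the points of a Poisson point process -/

section RealSums

variable {Ω E : Type*} [MeasurableSpace Ω] [MeasurableSpace E] {μ : Measure Ω} {z : ℕ → Ω → E}
  {m : Measure E}

lemma integrable_of_ae_bounded_of_support {f : E → ℝ} (hf : Measurable f) {C : ℝ}
    (hfC : ∀ᵐ x ∂m, f x ∈ Set.Icc 0 C) {K : Set E} (hmK : m K < ⊤) (hfK : ∀ x, x ∉ K → f x = 0) :
    Integrable f m := by
  rw [← integrableOn_iff_integrable_of_support_subset (s := K) fun x hx => by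
    by_contra h
    exact hx (hfK x h)]
  refine Measure.integrableOn_of_bounded (M := C) hmK.ne hf.aestronglyMeasurable ?_
  refine ae_restrict_of_ae (hfC.mono fun x hx => ?_)
  rw [Real.norm_eq_abs, abs_of_nonneg hx.1]
  exact hx.2

namespace IsPoissonPointProcess

variable (hz : IsPoissonPointProcess μ z m)
include hz

lemma ae_summable {f : E → ℝ} {K : Set E} (hK : MeasurableSet K)
    (hmK : m K < ⊤) (hfK : ∀ x, x ∉ K → f x = 0) : ∀ᵐ ω ∂μ, Summable fun k => f (z k ω) := by
  filter_upwards [hz.ae_finite_mem hK hmK] with ω hω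
  refine summable_of_hasFiniteSupport (hω.subset fun k hk => ?_)
  by_contra h
  exact hk (hfK _ h)

variable {f : E → ℝ} (hf : Measurable f) {C : ℝ} (hfC : ∀ᵐ x ∂m, f x ∈ Set.Icc 0 C) {K : Set E}
  (hK : MeasurableSet K) (hmK : m K < ⊤) (hfK : ∀ x, x ∉ K → f x = 0)
include hfC hK hmK hfK

lemma ae_ofReal_tsum_comp :
    ∀ᵐ ω ∂μ, ENNReal.ofReal (∑' k, f (z k ω)) = ∑' k, ENNReal.ofReal (f (z k ω)) := by
  filter_upwards [hz.ae_forall_of_ae hfC, hz.ae_summable hK hmK hfK] with ω hω hs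
  exact ENNReal.ofReal_tsum_of_nonneg (fun k => (hω k).1) hs

omit hK hmK hfK in
lemma ae_tsum_comp_nonneg : ∀ᵐ ω ∂μ, 0 ≤ ∑' k, f (z k ω) := by
  filter_upwards [hz.ae_forall_of_ae hfC] with ω hω
  exact tsum_nonneg fun k => (hω k).1

include hf

lemma lintegral_ofReal_tsum_comp_sq :
    ∫⁻ ω, ENNReal.ofReal ((∑' k, f (z k ω)) ^ 2) ∂μ
      = ENNReal.ofReal (∫ x, f x ^ 2 ∂m + (∫ x, f x ∂m) ^ 2) := by
  have hfi := integrable_of_ae_bounded_of_support hf hfC hmK hfK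
  have hfi2 : Integrable (fun x => f x ^ 2) m :=
    integrable_of_ae_bounded_of_support (hf.pow_const 2) (C := C ^ 2)
      (hfC.mono fun x hx => ⟨sq_nonneg _, pow_le_pow_left₀ hx.1 hx.2 2⟩) hmK
      (fun x hx => by simp [hfK x hx])
  have hf0 : 0 ≤ᵐ[m] f := hfC.mono fun x hx => hx.1
  have h0 : 0 ≤ ∫ x, f x ∂m := integral_nonneg_of_ae hf0
  have h := hz.lintegral_tsum_comp_mul_tsum_comp hK hmK (f := fun x => ENNReal.ofReal (f x))
    (g := fun x => ENNReal.ofReal (f x)) hf.ennreal_ofReal (fun x hx => by simp [hfK x hx])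
    hf.ennreal_ofReal (fun x hx => by simp [hfK x hx])
  rw [← ofReal_integral_eq_lintegral_ofReal hfi hf0, ← ENNReal.ofReal_mul h0] at h
  have h2 : ∫⁻ x, ENNReal.ofReal (f x) * ENNReal.ofReal (f x) ∂m
      = ENNReal.ofReal (∫ x, f x ^ 2 ∂m) := by
    rw [ofReal_integral_eq_lintegral_ofReal hfi2 (Eventually.of_forall fun x => sq_nonneg _)]
    refine lintegral_congr_ae (hf0.mono fun x hx => ?_)
    simp only
    rw [← ENNReal.ofReal_mul hx, sq]
  rw [h2, ← ENNReal.ofReal_add (integral_nonneg fun x => sq_nonneg _) (mul_nonneg h0 h0),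
    ← sq] at h
  rw [← h]
  refine lintegral_congr_ae ?_
  filter_upwards [hz.ae_ofReal_tsum_comp hfC hK hmK hfK,
    hz.ae_tsum_comp_nonneg hfC] with ω hω hω0
  rw [sq, ENNReal.ofReal_mul hω0, hω]

lemma memLp_tsum_comp : MemLp (fun ω => ∑' k, f (z k ω)) 2 μ := by
  have hm : Measurable fun ω => ∑' k, f (z k ω) := measurable_tsum_comp hz.measurable_point hf
  rw [memLp_two_iff_integrable_sq hm.aestronglyMeasurable]
  refine ⟨(hm.pow_const 2).aestronglyMeasurable, ?_⟩
  rw [hasFiniteIntegral_iff_ofReal (Eventually.of_forall fun ω => sq_nonneg _),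
    hz.lintegral_ofReal_tsum_comp_sq hf hfC hK hmK hfK]
  exact ENNReal.ofReal_lt_top

lemma integral_tsum_comp : ∫ ω, ∑' k, f (z k ω) ∂μ = ∫ x, f x ∂m := by
  have hfi := integrable_of_ae_bounded_of_support hf hfC hmK hfK
  have hf0 : 0 ≤ᵐ[m] f := hfC.mono fun x hx => hx.1
  have h := hz.lintegral_tsum_comp hK hmK (g := fun x => ENNReal.ofReal (f x))
    hf.ennreal_ofReal (fun x hx => by simp [hfK x hx])
  rw [integral_eq_lintegral_of_nonneg_ae (hz.ae_tsum_comp_nonneg hfC)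
    (measurable_tsum_comp hz.measurable_point hf).aestronglyMeasurable,
    integral_eq_lintegral_of_nonneg_ae hf0 hf.aestronglyMeasurable, ← h]
  congr 1
  exact lintegral_congr_ae (hz.ae_ofReal_tsum_comp hfC hK hmK hfK)

lemma integral_tsum_comp_sq :
    ∫ ω, (∑' k, f (z k ω)) ^ 2 ∂μ = ∫ x, f x ^ 2 ∂m + (∫ x, f x ∂m) ^ 2 := by
  rw [integral_eq_lintegral_of_nonneg_ae (Eventually.of_forall fun ω => sq_nonneg _)
    ((measurable_tsum_comp hz.measurable_point hf).pow_const 2).aestronglyMeasurable,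
    hz.lintegral_ofReal_tsum_comp_sq hf hfC hK hmK hfK, ENNReal.toReal_ofReal]
  exact add_nonneg (integral_nonneg fun x => sq_nonneg _) (sq_nonneg _)

lemma variance_tsum_comp [IsProbabilityMeasure μ] :
    Var[fun ω => ∑' k, f (z k ω); μ] = ∫ x, f x ^ 2 ∂m := by
  rw [variance_eq_sub (hz.memLp_tsum_comp hf hfC hK hmK hfK)]
  have h1 := hz.integral_tsum_comp_sq hf hfC hK hmK hfK
  have h2 := hz.integral_tsum_comp hf hfC hK hmK hfK
  simp only [Pi.pow_apply]
  rw [h1, h2]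
  ring

end IsPoissonPointProcess

end RealSums

/-! ### Independence of the future from the past -/

section Counting

variable {Ω E : Type*} {z : ℕ → Ω → E} {B : Set E} {ω : Ω}

lemma card_le_pointCount (s : Finset ℕ) (hs : ∀ k ∈ s, z k ω ∈ B) :
    (s.card : ENNReal) ≤ pointCount z B ω := by
  refine le_trans (le_of_eq ?_) (ENNReal.sum_le_tsum s)
  rw [Finset.sum_congr rfl fun k hk => Set.indicator_of_mem (hs k hk) _]
  simp

lemma pointCount_le_card (s : Finset ℕ) (hs : ∀ k, z k ω ∈ B → k ∈ s) :
    pointCount z B ω ≤ s.card := by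
  unfold pointCount
  rw [tsum_eq_sum (s := s) fun k hk => Set.indicator_of_notMem (fun h => hk (hs k h)) _]
  refine (Finset.sum_le_card_nsmul s _ 1 fun k _ => ?_).trans (by simp)
  exact Set.indicator_le (fun _ _ => le_rfl) _

end Counting

namespace JobStream

variable {Ω : Type*} [MeasurableSpace Ω] {μ : Measure Ω} {J : JobStream Ω} {rate : ℝ}
  {ν : Measure (ℝ × ℝ)}

omit [MeasurableSpace Ω] in
-- Since numbering starts at 0 and follows arrival, job `k` is the one preceded by exactly `k`
-- points. Rational `p` and `q` isolate it, which keeps the union countable, and the minimum with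
-- `t` keeps all sets in the past of `t`.
lemma mem_arrived_iff_exists_pointCount {ω : Ω} (hω : StrictMono fun k => J.arrival k ω) (t : ℝ)
    (k : ℕ) (B : Set (ℝ × ℝ × ℝ)) :
    (J.arrival k ω ≤ t ∧ J.job k ω ∈ B) ↔ ∃ p q : ℚ,
      pointCount J.job {x | x.1 ≤ min (p : ℝ) t} ω = k ∧
      pointCount J.job {x | min (p : ℝ) t < x.1 ∧ x.1 ≤ min (q : ℝ) t} ω = 1 ∧
      pointCount J.job ({x | min (p : ℝ) t < x.1 ∧ x.1 ≤ min (q : ℝ) t} ∩ B) ω = 1 := by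
  have hmono : ∀ {i j}, i < j → J.arrival i ω < J.arrival j ω := fun h => hω h
  have hle : ∀ {i j}, J.arrival i ω ≤ J.arrival j ω → i ≤ j := fun h => hω.le_iff_le.1 h
  constructor
  · rintro ⟨hkt, hkB⟩
    -- `p` separates job `k` from its predecessor, if any, and `q` separates it from its successor.
    obtain ⟨p, hp1, hp2⟩ : ∃ p : ℚ, (∀ j < k, J.arrival j ω ≤ p) ∧ (p : ℝ) < J.arrival k ω := by
      rcases Nat.eq_zero_or_pos k with rfl | hk
      · obtain ⟨p, hp⟩ := exists_rat_lt (J.arrival 0 ω)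
        exact ⟨p, fun j hj => absurd hj (by simp), hp⟩
      · obtain ⟨p, hp1, hp2⟩ := exists_rat_btwn (hmono (show k - 1 < k by lia))
        exact ⟨p, fun j hj => (hω.monotone (show j ≤ k - 1 by lia)).trans hp1.le, hp2⟩
    obtain ⟨q, hq1, hq2⟩ := exists_rat_btwn (hmono (Nat.lt_succ_self k))
    have hpt : min (p : ℝ) t = p := min_eq_left (hp2.le.trans hkt)
    have hkq : J.arrival k ω ≤ min (q : ℝ) t := le_min hq1.le hkt
    have hq : ∀ j, J.arrival j ω ≤ min (q : ℝ) t → j ≤ k := fun j hj => by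
      by_contra h
      have := hω.monotone (show k + 1 ≤ j by lia)
      linarith [min_le_left (q : ℝ) t]
    refine ⟨p, q, le_antisymm ?_ ?_, le_antisymm ?_ ?_, le_antisymm ?_ ?_⟩
    · refine (pointCount_le_card (Finset.range k) fun j hj => ?_).trans (by simp)
      have hj : J.arrival j ω ≤ min (p : ℝ) t := hj
      rw [hpt] at hj
      rw [Finset.mem_range]
      exact hω.lt_iff_lt.1 (hj.trans_lt hp2)
    · refine le_trans (by simp) (card_le_pointCount (Finset.range k) fun j hj => ?_)
      change J.arrival j ω ≤ min (p : ℝ) t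
      rw [hpt]
      exact hp1 j (Finset.mem_range.1 hj)
    · refine (pointCount_le_card {k} fun j hj => ?_).trans (by simp)
      have hj : min (p : ℝ) t < J.arrival j ω ∧ J.arrival j ω ≤ min (q : ℝ) t := hj
      rw [hpt] at hj
      rw [Finset.mem_singleton]
      refine le_antisymm (hq j hj.2) ?_
      by_contra h
      linarith [hp1 j (by lia)]
    · refine le_trans (by simp) (card_le_pointCount {k} fun j hj => ?_)
      rw [Finset.mem_singleton.1 hj]
      exact ⟨hpt.trans_lt hp2, hkq⟩
    · refine (pointCount_le_card {k} fun j hj => ?_).trans (by simp)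
      have hj : min (p : ℝ) t < J.arrival j ω ∧ J.arrival j ω ≤ min (q : ℝ) t := hj.1
      rw [hpt] at hj
      rw [Finset.mem_singleton]
      refine le_antisymm (hq j hj.2) ?_
      by_contra h
      linarith [hp1 j (by lia)]
    · refine le_trans (by simp) (card_le_pointCount {k} fun j hj => ?_)
      rw [Finset.mem_singleton.1 hj]
      exact ⟨⟨hpt.trans_lt hp2, hkq⟩, hkB⟩
  · rintro ⟨p, q, h1, h2, h3⟩
    have hk : min (p : ℝ) t < J.arrival k ω := by
      by_contra! h
      have := card_le_pointCount (z := J.job) (B := {x | x.1 ≤ min (p : ℝ) t}) (ω := ω)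
        (Finset.range (k + 1)) fun j hj =>
          (hω.monotone (Nat.lt_succ_iff.1 (Finset.mem_range.1 hj))).trans h
      rw [h1, Finset.card_range, Nat.cast_le] at this
      lia
    obtain ⟨j, hj⟩ : ∃ j, J.job j ω ∈ {x | min (p : ℝ) t < x.1 ∧ x.1 ≤ min (q : ℝ) t} ∩ B := by
      by_contra! h
      have := pointCount_le_card (z := J.job)
        (B := {x | min (p : ℝ) t < x.1 ∧ x.1 ≤ min (q : ℝ) t} ∩ B) (ω := ω) ∅
        fun j hj => absurd hj (h j)
      rw [h3] at this
      simp at this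
    have hj1 : min (p : ℝ) t < J.arrival j ω ∧ J.arrival j ω ≤ min (q : ℝ) t := hj.1
    have hkj : k ≤ j := by
      by_contra! h
      have := pointCount_le_card (z := J.job) (B := {x | x.1 ≤ min (p : ℝ) t}) (ω := ω)
        (Finset.range j) fun i hi => by
          have hi : J.arrival i ω ≤ min (p : ℝ) t := hi
          exact Finset.mem_range.2 (hω.lt_iff_lt.1 (hi.trans_lt hj1.1))
      rw [h1, Finset.card_range, Nat.cast_le] at this
      lia
    have hjk : j = k := by
      by_contra hne
      have := card_le_pointCount (z := J.job)
        (B := {x | min (p : ℝ) t < x.1 ∧ x.1 ≤ min (q : ℝ) t}) (ω := ω) {k, j} fun i hi => by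
          rcases Finset.mem_insert.1 hi with rfl | hi
          · exact ⟨hk, (hω.monotone hkj).trans hj1.2⟩
          · rw [Finset.mem_singleton.1 hi]
            exact hj1
      rw [h2, Finset.card_pair (Ne.symm hne)] at this
      norm_num at this
    subst hjk
    exact ⟨hj1.2.trans (min_le_right _ _), hj.2⟩

namespace IsStationaryPoisson

variable (hJ : J.IsStationaryPoisson μ rate ν)
include hJ

lemma past_le (t : ℝ) : J.past t ≤ ‹MeasurableSpace Ω› := by
  refine MeasurableSpace.generateFrom_le ?_
  rintro _ ⟨k, B, hB, rfl⟩
  have hk := hJ.poisson.measurable_point k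
  exact (measurableSet_le (measurable_fst.comp hk) measurable_const).inter (hk hB)

/-- The jobs are ordered only almost surely, so labelled events are count events up to null sets. -/
lemma past_le_eventuallyMeasurableSpace (t : ℝ) :
    J.past t ≤ eventuallyMeasurableSpace (countEvents J.job {x | x.1 ≤ t}) (ae μ) := by
  refine MeasurableSpace.generateFrom_le ?_
  rintro _ ⟨k, B, hB, rfl⟩
  refine ⟨{ω | ∃ p q : ℚ,
      pointCount J.job {x | x.1 ≤ min (p : ℝ) t} ω = k ∧
      pointCount J.job {x | min (p : ℝ) t < x.1 ∧ x.1 ≤ min (q : ℝ) t} ω = 1 ∧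
      pointCount J.job ({x | min (p : ℝ) t < x.1 ∧ x.1 ≤ min (q : ℝ) t} ∩ B) ω = 1}, ?_, ?_⟩
  · have hI : ∀ a b : ℝ, MeasurableSet {x : ℝ × ℝ × ℝ | a < x.1 ∧ x.1 ≤ b} := fun a b =>
      (measurableSet_lt measurable_const measurable_fst).inter
        (measurableSet_le measurable_fst measurable_const)
    have hset : ∀ {C : Set (ℝ × ℝ × ℝ)} (n : ENNReal), MeasurableSet C → C ⊆ {x | x.1 ≤ t} →
        MeasurableSet[countEvents J.job {x | x.1 ≤ t}] {ω | pointCount J.job C ω = n} :=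
      fun n hC hCt => measurable_pointCount_countEvents hC hCt (measurableSet_singleton n)
    have hIt : ∀ a q : ℝ, {x : ℝ × ℝ × ℝ | a < x.1 ∧ x.1 ≤ min q t} ⊆ {x | x.1 ≤ t} :=
      fun a q x hx => hx.2.trans (min_le_right _ _)
    simp only [Set.ofPred_exists]
    refine MeasurableSet.iUnion fun p => MeasurableSet.iUnion fun q => ?_
    refine (hset _ (measurableSet_le measurable_fst measurable_const)
      fun x (hx : x.1 ≤ min (p : ℝ) t) => hx.trans (min_le_right _ _)).inter ((hset _ (hI _ _) (hIt _ _)).inter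
        (hset _ ((hI _ _).inter hB) (Set.inter_subset_left.trans (hIt _ _))))
  · filter_upwards [hJ.ordered] with ω hω
    exact propext (mem_arrived_iff_exists_pointCount hω t k B)

/-- Null sets do not affect independence, so the independence of counts over disjoint sets carries
over to labelled events. -/
lemma indep_past [IsProbabilityMeasure μ] (t : ℝ) {B : Set (ℝ × ℝ × ℝ)} (hB : MeasurableSet B)
    (hBt : ∀ x ∈ B, t < x.1) :
    Indep (J.past t) (MeasurableSpace.comap (pointCount J.job B) inferInstance) μ := by
  have h := hJ.poisson.indep_countEvents (R := {x | x.1 ≤ t})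
    (measurableSet_le measurable_fst measurable_const) hB
    (Set.disjoint_left.2 fun x hx hxB => (hBt x hxB).not_ge hx)
  rw [Indep_iff] at h ⊢
  intro s₁ s₂ hs₁ hs₂
  obtain ⟨s, hs, hs'⟩ := hJ.past_le_eventuallyMeasurableSpace t s₁ hs₁
  rw [measure_congr hs', measure_congr (hs'.inter (ae_eq_refl s₂)), h s s₂ hs hs₂]

end IsStationaryPoisson

end JobStream

/-! ### The intensity measure of a job stream -/

/-- The intensity measure of a stationary marked Poisson arrival process on `[0, ∞)`. -/
noncomputable abbrev jobIntensity (rate : ℝ) (ν : Measure (ℝ × ℝ)) : Measure (ℝ × ℝ × ℝ) :=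
  (ENNReal.ofReal rate • volume.restrict (Set.Ici (0 : ℝ))).prod ν

/-- Jobs, as points (arrival time; demand, sojourn time), that arrive at time `t` or earlier. -/
def arrivedJobs (t : ℝ) : Set (ℝ × ℝ × ℝ) := {x | x.1 ≤ t}

/-- Jobs that are present at time `t`: they have arrived and their deadline is not over. -/
def activeJobs (t : ℝ) : Set (ℝ × ℝ × ℝ) := {x | x.1 ≤ t ∧ t < x.1 + x.2.2}

/-- Jobs that arrive in the time interval `(s, t]`. -/
def jobsBetween (s t : ℝ) : Set (ℝ × ℝ × ℝ) := {x | s < x.1 ∧ x.1 ≤ t}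

lemma measurableSet_arrivedJobs (t : ℝ) : MeasurableSet (arrivedJobs t) :=
  measurableSet_le measurable_fst measurable_const

lemma measurableSet_activeJobs (t : ℝ) : MeasurableSet (activeJobs t) :=
  (measurableSet_le measurable_fst measurable_const).inter
    (measurableSet_lt measurable_const (measurable_fst.add measurable_snd.snd))

lemma measurableSet_jobsBetween (s t : ℝ) : MeasurableSet (jobsBetween s t) :=
  (measurableSet_lt measurable_const measurable_fst).inter
    (measurableSet_le measurable_fst measurable_const)

lemma activeJobs_subset (t : ℝ) : activeJobs t ⊆ arrivedJobs t := fun _ hx => hx.1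

lemma jobsBetween_subset (s t : ℝ) : jobsBetween s t ⊆ arrivedJobs t := fun _ hx => hx.2

section Intensity

variable {rate : ℝ} {ν : Measure (ℝ × ℝ)} [IsProbabilityMeasure ν]

lemma jobIntensity_prod_univ (I : Set ℝ) :
    jobIntensity rate ν (I ×ˢ Set.univ)
      = ENNReal.ofReal rate * volume.restrict (Set.Ici (0 : ℝ)) I := by
  rw [Measure.prod_prod, measure_univ, mul_one]
  rfl

lemma jobIntensity_arrivedJobs_lt_top (t : ℝ) : jobIntensity rate ν (arrivedJobs t) < ⊤ := by
  have h : arrivedJobs t = Set.Iic t ×ˢ Set.univ := by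
    ext x
    simp [arrivedJobs]
  rw [h, jobIntensity_prod_univ, Measure.restrict_apply measurableSet_Iic, Set.inter_comm,
    Set.Ici_inter_Iic, Real.volume_Icc]
  exact ENNReal.mul_lt_top ENNReal.ofReal_lt_top ENNReal.ofReal_lt_top

lemma jobIntensity_jobsBetween_le (t : ℝ) {R : ℝ} :
    jobIntensity rate ν (jobsBetween (t - R) t) ≤ (rate.toNNReal * R.toNNReal : NNReal) := by
  have h : jobsBetween (t - R) t = Set.Ioc (t - R) t ×ˢ Set.univ := by
    ext x
    simp [jobsBetween]
  rw [h, jobIntensity_prod_univ, ENNReal.coe_mul]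
  refine mul_le_mul' le_rfl ((Measure.restrict_apply_le _ _).trans ?_)
  rw [Real.volume_Ioc, sub_sub_cancel]
  rfl

omit [IsProbabilityMeasure ν] in
lemma ae_jobIntensity {p : ℝ × ℝ → Prop} (hν : ∀ᵐ x ∂ν, p x) :
    ∀ᵐ x ∂(jobIntensity rate ν), 0 ≤ x.1 ∧ p x.2 := by
  have h1 : ∀ᵐ a ∂(ENNReal.ofReal rate • volume.restrict (Set.Ici (0 : ℝ))), 0 ≤ a :=
    Measure.ae_smul_measure (ae_restrict_mem measurableSet_Ici) _
  filter_upwards [Measure.quasiMeasurePreserving_fst.ae h1,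
    Measure.quasiMeasurePreserving_snd.ae hν] with x hx1 hx2
  exact ⟨hx1, hx2⟩

/-- By Fubini, each mark is weighted by the length of its set of admissible arrival times. -/
lemma integral_jobIntensity_indicator (hrate : 0 ≤ rate) {W : Set (ℝ × ℝ × ℝ)}
    (hW : MeasurableSet W) {g : ℝ × ℝ → ℝ}
    (hint : Integrable (W.indicator fun x => g x.2) (jobIntensity rate ν)) :
    ∫ x, W.indicator (fun x => g x.2) x ∂(jobIntensity rate ν)
      = rate * ∫ p, g p * volume.real {a | 0 ≤ a ∧ (a, p) ∈ W} ∂ν := by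
  rw [integral_prod_symm _ hint, ← integral_const_mul]
  refine integral_congr_ae (Eventually.of_forall fun p => ?_)
  have hWp : MeasurableSet {a : ℝ | (a, p) ∈ W} := hW.preimage measurable_prodMk_right
  have h1 : ∀ a : ℝ, W.indicator (fun x => g x.2) (a, p)
      = {a : ℝ | (a, p) ∈ W}.indicator (fun _ => g p) a := fun a => rfl
  simp only [h1]
  rw [integral_indicator_const _ hWp, smul_eq_mul, measureReal_def, Measure.smul_apply,
    Measure.restrict_apply hWp, smul_eq_mul, ENNReal.toReal_mul, ENNReal.toReal_ofReal hrate]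
  have h2 : {a : ℝ | (a, p) ∈ W} ∩ Set.Ici 0 = {a | 0 ≤ a ∧ (a, p) ∈ W} := by
    ext a
    simp [and_comm]
  rw [h2, ← measureReal_def]
  ring

lemma volume_real_arrivedJobs {T : ℝ} (hT : 0 ≤ T) (p : ℝ × ℝ) :
    volume.real {a | 0 ≤ a ∧ (a, p) ∈ arrivedJobs T} = T := by
  have h : {a | 0 ≤ a ∧ (a, p) ∈ arrivedJobs T} = Set.Icc 0 T := by
    ext a
    simp [arrivedJobs]
  rw [h, Real.volume_real_Icc_of_le hT, sub_zero]

/-- Equality can fail for `t < p.2`, since the window of arrivals is then cut off at time 0. -/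
lemma volume_real_activeJobs_le (t : ℝ) {p : ℝ × ℝ} (hp : 0 ≤ p.2) :
    volume.real {a | 0 ≤ a ∧ (a, p) ∈ activeJobs t} ≤ p.2 := by
  have h : {a | 0 ≤ a ∧ (a, p) ∈ activeJobs t} ⊆ Set.Ioc (t - p.2) t := fun a ha =>
    ⟨by linarith [ha.2.2], ha.2.1⟩
  refine (measureReal_mono h (by simp)).trans ?_
  rw [Real.volume_real_Ioc_of_le (by linarith), sub_sub_cancel]

lemma volume_real_activeJobs {t : ℝ} {p : ℝ × ℝ} (hp : 0 ≤ p.2) (hpt : p.2 ≤ t) :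
    volume.real {a | 0 ≤ a ∧ (a, p) ∈ activeJobs t} = p.2 := by
  have h : {a | 0 ≤ a ∧ (a, p) ∈ activeJobs t} = Set.Ioc (t - p.2) t := by
    ext a
    simp only [activeJobs, Set.mem_ofPred_eq, Set.mem_Ioc]
    constructor
    · rintro ⟨h0, h1, h2⟩
      exact ⟨by linarith, h1⟩
    · rintro ⟨h1, h2⟩
      exact ⟨by linarith, h2, by linarith⟩
  rw [h, Real.volume_real_Ioc_of_le (by linarith), sub_sub_cancel]

end Intensity

/-- The marks that occur: the demand is at most the sojourn time, which is at most `R`. -/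
def IsValidMark (R : ℝ) (p : ℝ × ℝ) : Prop := 0 ≤ p.1 ∧ p.1 ≤ p.2 ∧ p.2 ≤ R

namespace JobStream

variable {Ω : Type*}

/-- The sum of `f` over all jobs. -/
noncomputable def jobSum (J : JobStream Ω) (f : ℝ × ℝ × ℝ → ℝ) (ω : Ω) : ℝ := ∑' k, f (J.job k ω)

/-- The almost sure properties of the jobs in a stationary Poisson stream with valid marks. -/
structure IsRegularAt (J : JobStream Ω) (R : ℝ) (ω : Ω) : Prop where
  arrival_nonneg : ∀ k, 0 ≤ J.arrival k ω
  mark : ∀ k, IsValidMark R (J.demand k ω, J.sojourn k ω)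
  finite : ∀ t, {k | J.arrival k ω ≤ t}.Finite

/-- The constraints on a service profile along a single path. -/
structure IsFeasibleAt (J : JobStream Ω) (r : ℕ → ℝ → Ω → ℝ) (ω : Ω) : Prop where
  measurable : ∀ k, Measurable fun t => r k t ω
  rate : ∀ k t, r k t ω ∈ Set.Icc (0 : ℝ) 1
  demand : ∀ k, ∫ t in Set.Ici (J.arrival k ω), r k t ω = J.demand k ω
  deadline : ∀ k t, r k t ω ≤
    (Set.Ico (J.arrival k ω) (J.arrival k ω + J.sojourn k ω)).indicator (fun _ => (1 : ℝ)) t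

/-! ### Consequences of the constraints along a single path -/

section Pathwise

variable {J : JobStream Ω} {R : ℝ} {ω : Ω} {r : ℕ → ℝ → Ω → ℝ}

lemma IsRegularAt.jobSum_eq_sum (h : J.IsRegularAt R ω) {t : ℝ} {f : ℝ × ℝ × ℝ → ℝ}
    (hf : ∀ x, x ∉ arrivedJobs t → f x = 0) :
    J.jobSum f ω = ∑ k ∈ (h.finite t).toFinset, f (J.job k ω) :=
  tsum_eq_sum fun _ hk => hf _ fun hx => hk ((h.finite t).mem_toFinset.2 hx)

lemma IsFeasibleAt.eq_zero (hr : J.IsFeasibleAt r ω) {k : ℕ} {t : ℝ}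
    (ht : J.job k ω ∉ activeJobs t) : r k t ω = 0 := by
  refine le_antisymm ((hr.deadline k t).trans (le_of_eq ?_)) (hr.rate k t).1
  exact Set.indicator_of_notMem (s := Set.Ico (J.arrival k ω) (J.arrival k ω + J.sojourn k ω)) ht _

lemma IsFeasibleAt.capacity_eq_sum (hr : J.IsFeasibleAt r ω) (h : J.IsRegularAt R ω) {t T : ℝ}
    (ht : t ≤ T) : capacity r t ω = ∑ k ∈ (h.finite T).toFinset, r k t ω :=
  tsum_eq_sum fun _ hk => hr.eq_zero fun hx =>
    hk ((h.finite T).mem_toFinset.2 (le_trans hx.1 ht))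

lemma IsFeasibleAt.capacity_nonneg (hr : J.IsFeasibleAt r ω) (t : ℝ) : 0 ≤ capacity r t ω :=
  tsum_nonneg fun k => (hr.rate k t).1

lemma IsFeasibleAt.ofReal_capacity (hr : J.IsFeasibleAt r ω) (h : J.IsRegularAt R ω) (t : ℝ) :
    ENNReal.ofReal (capacity r t ω) = ∑' k, ENNReal.ofReal (r k t ω) := by
  refine ENNReal.ofReal_tsum_of_nonneg (fun k => (hr.rate k t).1) ?_
  refine summable_of_hasFiniteSupport ((h.finite t).subset fun k hk => ?_)
  by_contra hkt
  exact hk (hr.eq_zero fun hx => hkt hx.1)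

/-- A job served at `t` has rate at most 1 and arrived less than `R` ago. The dominating Poisson
count has mean at most `rate * R`, which makes moment bounds uniform in `t`. -/
lemma IsFeasibleAt.ofReal_capacity_le_pointCount (hr : J.IsFeasibleAt r ω)
    (h : J.IsRegularAt R ω) (t : ℝ) :
    ENNReal.ofReal (capacity r t ω) ≤ pointCount J.job (jobsBetween (t - R) t) ω := by
  rw [hr.ofReal_capacity h]
  refine ENNReal.tsum_le_tsum fun k => ?_
  by_cases hk : J.job k ω ∈ activeJobs t
  · rw [Set.indicator_of_mem]
    · exact ENNReal.ofReal_le_one.2 (hr.rate k t).2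
    · have h1 : J.sojourn k ω ≤ R := (h.mark k).2.2
      have h2 : t < J.arrival k ω + J.sojourn k ω := hk.2
      exact ⟨by change t - R < J.arrival k ω; linarith, hk.1⟩
  · rw [hr.eq_zero hk, ENNReal.ofReal_zero]
    exact zero_le

lemma IsFeasibleAt.capacity_le_arrived (hr : J.IsFeasibleAt r ω) (h : J.IsRegularAt R ω)
    {t T : ℝ} (ht : t ≤ T) :
    capacity r t ω ≤ J.jobSum ((arrivedJobs T).indicator fun _ => 1) ω := by
  rw [hr.capacity_eq_sum h ht, h.jobSum_eq_sum (t := T) fun x hx =>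
    Set.indicator_of_notMem hx _]
  refine Finset.sum_le_sum fun k hk => ?_
  rw [Set.indicator_of_mem]
  · exact (hr.rate k t).2
  · exact (h.finite T).mem_toFinset.1 hk

lemma IsFeasibleAt.integrable (hr : J.IsFeasibleAt r ω) (k : ℕ) :
    Integrable fun t => r k t ω := by
  refine Integrable.mono' (g := (Set.Ico (J.arrival k ω)
    (J.arrival k ω + J.sojourn k ω)).indicator fun _ => (1 : ℝ)) ?_
    (hr.measurable k).aestronglyMeasurable (Eventually.of_forall fun t => ?_)
  · exact (integrable_indicator_iff measurableSet_Ico).2 (integrableOn_const (by simp))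
  · rw [Real.norm_eq_abs, abs_of_nonneg (hr.rate k t).1]
    exact hr.deadline k t

lemma IsFeasibleAt.integral_eq (hr : J.IsFeasibleAt r ω) (k : ℕ) :
    ∫ t, r k t ω = J.demand k ω := by
  rw [← hr.demand k, setIntegral_eq_integral_of_forall_compl_eq_zero]
  exact fun t ht => hr.eq_zero fun hx => ht hx.1

/-- The total remaining demand is between `0` and the total demand of the jobs present. -/
lemma IsFeasibleAt.backlog_mem_Icc (hr : J.IsFeasibleAt r ω) (h : J.IsRegularAt R ω) {t : ℝ}
    (ht : 0 ≤ t) :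
    J.jobSum ((arrivedJobs t).indicator fun x => x.2.1) ω - ∫ s in (0 : ℝ)..t, capacity r s ω
      ∈ Set.Icc 0 (J.jobSum ((activeJobs t).indicator fun x => x.2.1) ω) := by
  have hcap : ∫ s in (0 : ℝ)..t, capacity r s ω
      = ∑ k ∈ (h.finite t).toFinset, ∫ s in (0 : ℝ)..t, r k s ω := by
    rw [← intervalIntegral.integral_finsetSum fun k _ => (hr.integrable k).intervalIntegrable]
    refine intervalIntegral.integral_congr fun s hs => ?_
    rw [Set.uIcc_of_le ht] at hs
    exact hr.capacity_eq_sum h hs.2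
  rw [hcap, h.jobSum_eq_sum (t := t) fun x hx => Set.indicator_of_notMem hx _,
    h.jobSum_eq_sum (t := t) fun x hx =>
      Set.indicator_of_notMem (fun hx' => hx (activeJobs_subset _ hx')) _,
    ← Finset.sum_sub_distrib]
  have hnn : ∀ k, 0 ≤ᵐ[volume] fun s => r k s ω := fun k =>
    Eventually.of_forall fun s => (hr.rate k s).1
  have hterm : ∀ k ∈ (h.finite t).toFinset,
      (arrivedJobs t).indicator (fun x => x.2.1) (J.job k ω) - ∫ s in (0 : ℝ)..t, r k s ω
        ∈ Set.Icc 0 ((activeJobs t).indicator (fun x => x.2.1) (J.job k ω)) := by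
    intro k hk
    have hkt : J.arrival k ω ≤ t := (h.finite t).mem_toFinset.1 hk
    rw [Set.indicator_of_mem (show J.job k ω ∈ arrivedJobs t from hkt)]
    change J.demand k ω - _ ∈ Set.Icc _ _
    have h0 : 0 ≤ ∫ s in (0 : ℝ)..t, r k s ω :=
      intervalIntegral.integral_nonneg ht fun s _ => (hr.rate k s).1
    have h1 : ∫ s in (0 : ℝ)..t, r k s ω ≤ J.demand k ω := by
      rw [← hr.integral_eq k, intervalIntegral.integral_of_le ht]
      exact setIntegral_le_integral (hr.integrable k) (hnn k)
    refine ⟨by linarith, ?_⟩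
    by_cases hact : J.job k ω ∈ activeJobs t
    · rw [Set.indicator_of_mem hact]
      change _ ≤ J.demand k ω
      linarith
    -- The deadline has passed, so all service took place before `t` and nothing remains.
    · rw [Set.indicator_of_notMem hact, intervalIntegral.integral_of_le ht,
        ← integral_Icc_eq_integral_Ioc, setIntegral_eq_integral_of_forall_compl_eq_zero,
        hr.integral_eq k, sub_self]
      intro s hs
      refine hr.eq_zero fun hx => hs ⟨(h.arrival_nonneg k).trans hx.1, ?_⟩
      by_contra! hts
      exact hact ⟨hkt, hts.trans hx.2⟩
  exact ⟨Finset.sum_nonneg fun k hk => (hterm k hk).1,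
    Finset.sum_le_sum fun k hk => (hterm k hk).2⟩

end Pathwise

section Almost

variable [MeasurableSpace Ω] {μ : Measure Ω} {J : JobStream Ω} {rate R : ℝ}
  {ν : Measure (ℝ × ℝ)} [IsProbabilityMeasure ν]

lemma IsStationaryPoisson.ae_isRegularAt (hJ : J.IsStationaryPoisson μ rate ν)
    (hν : ∀ᵐ p ∂ν, IsValidMark R p) : ∀ᵐ ω ∂μ, J.IsRegularAt R ω := by
  have hfin : ∀ᵐ ω ∂μ, ∀ n : ℕ, {k | J.job k ω ∈ arrivedJobs n}.Finite :=
    ae_all_iff.2 fun n => hJ.poisson.ae_finite_mem (measurableSet_arrivedJobs n)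
      (jobIntensity_arrivedJobs_lt_top _)
  filter_upwards [hJ.poisson.ae_forall_of_ae (ae_jobIntensity hν), hfin] with ω h1 h2
  refine ⟨fun k => (h1 k).1, fun k => (h1 k).2, fun t => (h2 ⌈t⌉₊).subset fun k hk => ?_⟩
  exact le_trans hk (Nat.le_ceil t)

lemma MeetsConstraints.ae_isFeasibleAt {r : ℕ → ℝ → Ω → ℝ} (hr : J.MeetsConstraints μ r)
    (hm : ∀ k, Measurable fun p : ℝ × Ω => r k p.1 p.2) : ∀ᵐ ω ∂μ, J.IsFeasibleAt r ω := by
  filter_upwards [hr.rate, hr.demand, hr.deadline] with ω h1 h2 h3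
  exact ⟨fun k => (hm k).comp measurable_prodMk_right, h1, h2, h3⟩

end Almost

end JobStream

namespace JobStream

variable {Ω : Type*} [MeasurableSpace Ω] {μ : Measure Ω} {J : JobStream Ω} {rate R : ℝ}
  {ν : Measure (ℝ × ℝ)}

/-! ### Moments of sums over the jobs of a stationary Poisson stream -/

section JobSums

variable {W : Set (ℝ × ℝ × ℝ)} {g : ℝ × ℝ → ℝ} {C : ℝ}

lemma ae_indicator_mem_Icc (hν : ∀ᵐ p ∂ν, IsValidMark R p)
    (hgC : ∀ p, IsValidMark R p → g p ∈ Set.Icc 0 C) :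
    ∀ᵐ x ∂(jobIntensity rate ν), W.indicator (fun x => g x.2) x ∈ Set.Icc 0 C := by
  filter_upwards [ae_jobIntensity hν] with x hx
  have h := hgC _ hx.2
  by_cases hxW : x ∈ W
  · rwa [Set.indicator_of_mem hxW]
  · rw [Set.indicator_of_notMem hxW]
    exact ⟨le_rfl, h.1.trans h.2⟩

lemma integrable_of_validMark [IsFiniteMeasure ν] (hν : ∀ᵐ p ∂ν, IsValidMark R p)
    (hg : Measurable g) (hgC : ∀ p, IsValidMark R p → g p ∈ Set.Icc 0 C) : Integrable g ν :=
  Integrable.of_bound hg.aestronglyMeasurable C (hν.mono fun p hp => by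
    rw [Real.norm_eq_abs, abs_of_nonneg (hgC p hp).1]
    exact (hgC p hp).2)

variable [IsProbabilityMeasure ν] (hJ : J.IsStationaryPoisson μ rate ν)
  (hν : ∀ᵐ p ∂ν, IsValidMark R p) (hW : MeasurableSet W) {t : ℝ} (hWt : W ⊆ arrivedJobs t)
  (hg : Measurable g) (hgC : ∀ p, IsValidMark R p → g p ∈ Set.Icc 0 C)
include hJ hν hW hWt hg hgC

lemma memLp_jobSum : MemLp (J.jobSum (W.indicator fun x => g x.2)) 2 μ :=
  hJ.poisson.memLp_tsum_comp ((hg.comp measurable_snd).indicator hW)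
    (ae_indicator_mem_Icc hν hgC) (measurableSet_arrivedJobs t)
    (jobIntensity_arrivedJobs_lt_top t) fun _ hx => Set.indicator_of_notMem (fun h => hx (hWt h)) _

lemma integral_jobSum_eq_integral : ∫ ω, J.jobSum (W.indicator fun x => g x.2) ω ∂μ
    = ∫ x, W.indicator (fun x => g x.2) x ∂(jobIntensity rate ν) :=
  hJ.poisson.integral_tsum_comp ((hg.comp measurable_snd).indicator hW)
    (ae_indicator_mem_Icc hν hgC) (measurableSet_arrivedJobs t)
    (jobIntensity_arrivedJobs_lt_top t) fun _ hx => Set.indicator_of_notMem (fun h => hx (hWt h)) _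

lemma integral_jobSum (hrate : 0 ≤ rate) : ∫ ω, J.jobSum (W.indicator fun x => g x.2) ω ∂μ
    = rate * ∫ p, g p * volume.real {a | 0 ≤ a ∧ (a, p) ∈ W} ∂ν := by
  rw [integral_jobSum_eq_integral hJ hν hW hWt hg hgC, integral_jobIntensity_indicator hrate hW]
  exact integrable_of_ae_bounded_of_support ((hg.comp measurable_snd).indicator hW)
    (ae_indicator_mem_Icc hν hgC) (jobIntensity_arrivedJobs_lt_top t)
    fun _ hx => Set.indicator_of_notMem (fun h => hx (hWt h)) _

lemma variance_jobSum [IsProbabilityMeasure μ] (hrate : 0 ≤ rate) :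
    Var[J.jobSum (W.indicator fun x => g x.2); μ]
      = rate * ∫ p, g p ^ 2 * volume.real {a | 0 ≤ a ∧ (a, p) ∈ W} ∂ν := by
  have h := hJ.poisson.variance_tsum_comp ((hg.comp measurable_snd).indicator hW)
    (ae_indicator_mem_Icc hν hgC) (measurableSet_arrivedJobs t)
    (jobIntensity_arrivedJobs_lt_top t)
    (fun _ hx => Set.indicator_of_notMem (fun h => hx (hWt h)) _)
  refine h.trans ?_
  have hg2 : ∀ p, IsValidMark R p → g p ^ 2 ∈ Set.Icc 0 (C ^ 2) := fun p hp =>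
    ⟨sq_nonneg _, pow_le_pow_left₀ (hgC p hp).1 (hgC p hp).2 2⟩
  rw [← integral_jobIntensity_indicator (g := fun p => g p ^ 2) hrate hW]
  · refine integral_congr_ae (Eventually.of_forall fun x => ?_)
    by_cases hx : x ∈ W <;> simp [hx]
  · exact integrable_of_ae_bounded_of_support
      (((hg.pow_const 2).comp measurable_snd).indicator hW)
      (ae_indicator_mem_Icc (g := fun p => g p ^ 2) hν hg2) (jobIntensity_arrivedJobs_lt_top t)
      fun _ hx => Set.indicator_of_notMem (fun h => hx (hWt h)) _

end JobSums

section Demand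

variable [IsProbabilityMeasure ν] [IsProbabilityMeasure μ] (hJ : J.IsStationaryPoisson μ rate ν)
  (hν : ∀ᵐ p ∂ν, IsValidMark R p)

lemma fst_mem_Icc_of_validMark {p : ℝ × ℝ} (hp : IsValidMark R p) : p.1 ∈ Set.Icc 0 R :=
  ⟨hp.1, hp.2.1.trans hp.2.2⟩

include hJ hν

/-- The second moment of the total demand of the jobs present. -/
lemma integral_jobSum_activeJobs_sq_le (hrate : 0 ≤ rate) (t : ℝ) :
    ∫ ω, J.jobSum ((activeJobs t).indicator fun x => x.2.1) ω ^ 2 ∂μ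
      ≤ rate * ∫ p, p.2 * p.1 ^ 2 ∂ν + (rate * ∫ p, p.2 * p.1 ∂ν) ^ 2 := by
  have hW := measurableSet_activeJobs t
  have hWt := activeJobs_subset t
  have hg : Measurable (Prod.fst : ℝ × ℝ → ℝ) := measurable_fst
  have hgC : ∀ p : ℝ × ℝ, IsValidMark R p → p.1 ∈ Set.Icc 0 R :=
    fun p hp => fst_mem_Icc_of_validMark hp
  have hv := variance_jobSum hJ hν hW hWt hg hgC hrate
  have hm := integral_jobSum hJ hν hW hWt hg hgC hrate
  rw [variance_eq_sub (memLp_jobSum hJ hν hW hWt hg hgC), hm, sub_eq_iff_eq_add] at hv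
  simp only [Pi.pow_apply] at hv
  rw [hv]
  have hR : ∀ {p : ℝ × ℝ}, IsValidMark R p → 0 ≤ p.2 := fun hp => hp.1.trans hp.2.1
  have h1 : ∫ p, p.1 ^ 2 * volume.real {a | 0 ≤ a ∧ (a, p) ∈ activeJobs t} ∂ν
      ≤ ∫ p, p.2 * p.1 ^ 2 ∂ν := by
    refine integral_mono_of_nonneg (Eventually.of_forall fun p => by positivity)
      (integrable_of_validMark hν (C := R * R ^ 2) (by fun_prop) fun p hp => ?_)
      (hν.mono fun p hp => ?_)
    · have := fst_mem_Icc_of_validMark hp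
      exact ⟨mul_nonneg (hR hp) (sq_nonneg _), mul_le_mul hp.2.2
        (pow_le_pow_left₀ this.1 this.2 2) (sq_nonneg _) ((hR hp).trans hp.2.2)⟩
    · simp only
      rw [mul_comm]
      exact mul_le_mul_of_nonneg_right (volume_real_activeJobs_le t (hR hp)) (sq_nonneg _)
  have h2 : ∫ p, p.1 * volume.real {a | 0 ≤ a ∧ (a, p) ∈ activeJobs t} ∂ν
      ≤ ∫ p, p.2 * p.1 ∂ν := by
    refine integral_mono_of_nonneg (hν.mono fun p hp => mul_nonneg hp.1 measureReal_nonneg)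
      (integrable_of_validMark hν (C := R * R) (by fun_prop) fun p hp => ?_)
      (hν.mono fun p hp => ?_)
    · have := fst_mem_Icc_of_validMark hp
      exact ⟨mul_nonneg (hR hp) hp.1, mul_le_mul hp.2.2 this.2 hp.1 ((hR hp).trans hp.2.2)⟩
    · simp only
      rw [mul_comm]
      exact mul_le_mul_of_nonneg_right (volume_real_activeJobs_le t (hR hp)) hp.1
  have h0 : 0 ≤ ∫ p, p.1 * volume.real {a | 0 ≤ a ∧ (a, p) ∈ activeJobs t} ∂ν :=
    integral_nonneg_of_ae (hν.mono fun p hp => mul_nonneg hp.1 measureReal_nonneg)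
  gcongr

end Demand

/-! ### The capacity of a feasible service profile -/

section Capacity

variable [IsProbabilityMeasure ν] [IsProbabilityMeasure μ] (hJ : J.IsStationaryPoisson μ rate ν)
  (hν : ∀ᵐ p ∂ν, IsValidMark R p) {r : ℕ → ℝ → Ω → ℝ}
  (hm : ∀ k, Measurable fun p : ℝ × Ω => r k p.1 p.2) (hr : J.MeetsConstraints μ r)

omit [MeasurableSpace Ω] in
lemma measurable_capacity_uncurry {mΩ : MeasurableSpace Ω} {r : ℕ → ℝ → Ω → ℝ}
    (hm : ∀ k, Measurable fun p : ℝ × Ω => r k p.1 p.2) :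
    Measurable fun p : ℝ × Ω => capacity r p.1 p.2 :=
  Measurable.tsum hm

omit [IsProbabilityMeasure ν] in
lemma measurable_capacity {r : ℕ → ℝ → Ω → ℝ}
    (hm : ∀ k, Measurable fun p : ℝ × Ω => r k p.1 p.2) (t : ℝ) : Measurable (capacity r t) :=
  (measurable_capacity_uncurry hm).comp measurable_prodMk_left

include hJ hν hm hr

omit [IsProbabilityMeasure μ] in
lemma exists_integral_capacity_pow_four_le :
    ∃ C : ℝ, ∀ t, Integrable (fun ω => capacity r t ω ^ 4) μ ∧
      ∫ ω, capacity r t ω ^ 4 ∂μ ≤ C := by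
  obtain ⟨C, hC⟩ := hJ.poisson.exists_lintegral_pointCount_pow_four_le
    (rate.toNNReal * R.toNNReal)
  refine ⟨C, fun t => ?_⟩
  have hle : ∫⁻ ω, ENNReal.ofReal (capacity r t ω ^ 4) ∂μ ≤ C := by
    refine le_trans (lintegral_mono_ae ?_) (hC (jobsBetween (t - R) t)
      (measurableSet_jobsBetween _ _) (jobIntensity_jobsBetween_le t))
    filter_upwards [hJ.ae_isRegularAt hν, hr.ae_isFeasibleAt hm] with ω h1 h2
    rw [ENNReal.ofReal_pow (h2.capacity_nonneg t)]
    exact pow_le_pow_left' (h2.ofReal_capacity_le_pointCount h1 t) 4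
  have hnn : ∀ ω, 0 ≤ capacity r t ω ^ 4 := fun ω => by positivity
  have hmeas : AEStronglyMeasurable (fun ω => capacity r t ω ^ 4) μ :=
    ((measurable_capacity hm t).pow_const 4).aestronglyMeasurable
  have hint : Integrable (fun ω => capacity r t ω ^ 4) μ :=
    ⟨hmeas, (hasFiniteIntegral_iff_ofReal (Eventually.of_forall hnn)).2
      (hle.trans_lt ENNReal.coe_lt_top)⟩
  refine ⟨hint, ?_⟩
  rw [integral_eq_lintegral_of_nonneg_ae (Eventually.of_forall hnn) hmeas]
  exact ENNReal.toReal_le_coe_of_le_coe hle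

lemma memLp_capacity (t : ℝ) : MemLp (capacity r t) 2 μ := by
  obtain ⟨C, hC⟩ := exists_integral_capacity_pow_four_le hJ hν hm hr
  have hmt := (measurable_capacity hm t).aestronglyMeasurable (μ := μ)
  refine (memLp_two_iff_integrable_sq hmt).2
    (((memLp_two_iff_integrable_sq (hmt.pow 2)).2 ?_).integrable one_le_two)
  refine (hC t).1.congr (Eventually.of_forall fun ω => ?_)
  simp only [Pi.pow_apply]
  ring

lemma exists_variance_capacity_le : ∃ C : ℝ, ∀ t, Var[capacity r t; μ] ≤ C := by
  obtain ⟨C, hC⟩ := exists_integral_capacity_pow_four_le hJ hν hm hr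
  refine ⟨1 + C, fun t => ?_⟩
  have hLp := memLp_capacity hJ hν hm hr t
  refine (variance_le_expectation_sq hLp.aestronglyMeasurable).trans ?_
  have h1 : ∫ ω, capacity r t ω ^ 2 ∂μ ≤ ∫ ω, (1 + capacity r t ω ^ 4) ∂μ :=
    integral_mono hLp.integrable_sq ((integrable_const _).add (hC t).1) fun ω => by
      simp only
      nlinarith [sq_nonneg (capacity r t ω ^ 2 - 1)]
  rw [integral_add (integrable_const _) (hC t).1] at h1
  simp only [integral_const, probReal_univ, smul_eq_mul, mul_one] at h1
  simp only [Pi.pow_apply]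
  linarith [(hC t).2]

omit hJ hν hr [IsProbabilityMeasure ν] in
lemma measurable_integral_capacity : Measurable fun t => ∫ ω, capacity r t ω ∂μ :=
  (measurable_capacity_uncurry hm).stronglyMeasurable.integral_prod_right'.measurable

omit hJ hν hr [IsProbabilityMeasure ν] in
lemma measurable_variance_capacity : Measurable fun t => Var[capacity r t; μ] := by
  have h : ∀ t, Var[capacity r t; μ]
      = ∫ ω, (capacity r t ω - ∫ ω', capacity r t ω' ∂μ) ^ 2 ∂μ := fun t =>
    variance_eq_integral (measurable_capacity hm t).aemeasurable
  simp only [h]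
  exact (((measurable_capacity_uncurry hm).sub
    ((measurable_integral_capacity hm).comp measurable_fst)).pow_const
      2).stronglyMeasurable.integral_prod_right'.measurable

/-- Up to time `s` the capacity is dominated by the number of arrivals, which is square integrable;
this permits Fubini. -/
lemma integral_integral_capacity {s : ℝ} (hs : 0 ≤ s) :
    ∫ ω, (∫ u in (0 : ℝ)..s, capacity r u ω) ∂μ = ∫ u in (0 : ℝ)..s, ∫ ω, capacity r u ω ∂μ ∧
    IntervalIntegrable (fun u => ∫ ω, capacity r u ω ∂μ) volume 0 s ∧
    MemLp (fun ω => ∫ u in (0 : ℝ)..s, capacity r u ω) 2 μ := by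
  have hN : MemLp (J.jobSum ((arrivedJobs s).indicator fun _ => (1 : ℝ))) 2 μ :=
    memLp_jobSum hJ hν (measurableSet_arrivedJobs s) subset_rfl (g := fun _ => 1)
      measurable_const (C := 1) fun p _ => ⟨zero_le_one, le_rfl⟩
  have hb : ∀ᵐ ω ∂μ, ∀ u ∈ Set.Ioc 0 s, ‖capacity r u ω‖
      ≤ J.jobSum ((arrivedJobs s).indicator fun _ => (1 : ℝ)) ω := by
    filter_upwards [hJ.ae_isRegularAt hν, hr.ae_isFeasibleAt hm] with ω h1 h2 u hu
    rw [Real.norm_eq_abs, abs_of_nonneg (h2.capacity_nonneg u)]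
    exact h2.capacity_le_arrived h1 hu.2
  have hint : Integrable (fun p : ℝ × Ω => capacity r p.1 p.2)
      ((volume.restrict (Set.Ioc 0 s)).prod μ) := by
    refine ((hN.integrable one_le_two).comp_snd _).mono'
      (measurable_capacity_uncurry hm).aestronglyMeasurable ?_
    have h1 : ∀ᵐ p ∂((volume.restrict (Set.Ioc 0 s)).prod μ), ∀ u ∈ Set.Ioc 0 s,
        ‖capacity r u p.2‖ ≤ J.jobSum ((arrivedJobs s).indicator fun _ => (1 : ℝ)) p.2 :=
      Measure.quasiMeasurePreserving_snd.ae hb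
    have h2 : ∀ᵐ p ∂((volume.restrict (Set.Ioc 0 s)).prod μ), p.1 ∈ Set.Ioc 0 s :=
      Measure.quasiMeasurePreserving_fst.ae (ae_restrict_mem measurableSet_Ioc)
    filter_upwards [h1, h2] with p hp1 hp2
    exact hp1 p.1 hp2
  refine ⟨?_, ?_, ?_⟩
  · simp only [intervalIntegral.integral_of_le hs]
    exact integral_integral_swap (f := fun ω u => capacity r u ω) hint.swap
  · rw [intervalIntegrable_iff_integrableOn_Ioc_of_le hs]
    exact hint.integral_prod_left
  · refine (hN.const_mul s).of_le ?_ ?_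
    · simp only [intervalIntegral.integral_of_le hs]
      exact ((measurable_capacity_uncurry hm).comp
        measurable_swap).stronglyMeasurable.integral_prod_right'.aestronglyMeasurable
    · filter_upwards [hb] with ω hω
      have := intervalIntegral.norm_integral_le_of_norm_le_const (a := 0) (b := s)
        (f := fun u => capacity r u ω) (by rwa [Set.uIoc_of_le hs])
      rw [sub_zero, abs_of_nonneg hs] at this
      refine this.trans ?_
      rw [mul_comm]
      exact le_abs_self _

end Capacity

end JobStream

/-! ### The lower bound on the variance of a centralized online policy -/

lemma measurable_tsum_ofReal {α : Type*} {mα : MeasurableSpace α} {f : ℕ → α → ℝ}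
    (hf : ∀ k, Measurable (f k)) : Measurable fun x => ∑' k, ENNReal.ofReal (f k x) :=
  Measurable.tsum fun k => (hf k).ennreal_ofReal

namespace JobStream

variable {Ω : Type*} [MeasurableSpace Ω] {μ : Measure Ω} {J : JobStream Ω} {rate R : ℝ}
  {ν : Measure (ℝ × ℝ)} [IsProbabilityMeasure ν] [IsProbabilityMeasure μ]
  (hJ : J.IsStationaryPoisson μ rate ν) (hν : ∀ᵐ p ∂ν, IsValidMark R p) {r : ℕ → ℝ → Ω → ℝ}
  (hon : J.IsCentralizedOnline μ r) (hr : J.MeetsConstraints μ r)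
include hJ hν hon hr

/-- The capacity at time `s` is uncorrelated with the demand that arrives after time `s`. -/
lemma integral_capacity_mul_jobSum_jobsBetween (s T : ℝ) :
    ∫ ω, capacity r s ω * J.jobSum ((jobsBetween s T).indicator fun x => x.2.1) ω ∂μ
      = (∫ ω, capacity r s ω ∂μ)
        * ∫ ω, J.jobSum ((jobsBetween s T).indicator fun x => x.2.1) ω ∂μ := by
  set f : ℝ × ℝ × ℝ → ℝ := (jobsBetween s T).indicator fun x => x.2.1 with hf
  have hfm : Measurable f := measurable_snd.fst.indicator (measurableSet_jobsBetween s T)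
  have hfC : ∀ᵐ x ∂(jobIntensity rate ν), f x ∈ Set.Icc 0 R :=
    ae_indicator_mem_Icc (g := Prod.fst) hν fun p hp => fst_mem_Icc_of_validMark hp
  have hfK : ∀ x, x ∉ jobsBetween s T → f x = 0 := fun x hx => Set.indicator_of_notMem hx _
  have hK := measurableSet_jobsBetween s T
  have hmK : jobIntensity rate ν (jobsBetween s T) < ⊤ :=
    (measure_mono (jobsBetween_subset s T)).trans_lt (jobIntensity_arrivedJobs_lt_top T)
  -- This is where the online property enters: the capacity at `s` is a function of the past, and
  -- the jobs in `(s, T]` are independent of it.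
  have hw : Measurable[J.past s] fun ω => ∑' k, ENNReal.ofReal (r k s ω) :=
    measurable_tsum_ofReal fun k => hon.adapted k s
  have key := hJ.poisson.lintegral_mul_tsum_comp_of_indep (hJ.past_le s) hK hmK
    (fun B hB hBK => hJ.indep_past s hB fun x hx => (hBK hx).1) hw hfm.ennreal_ofReal
    (fun x hx => by simp [hfK x hx])
  have hX := hJ.poisson.ae_ofReal_tsum_comp hfC hK hmK hfK
  have hX0 : ∀ᵐ ω ∂μ, 0 ≤ J.jobSum f ω := hJ.poisson.ae_tsum_comp_nonneg hfC
  have hP : ∀ᵐ ω ∂μ, 0 ≤ capacity r s ω ∧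
      ENNReal.ofReal (capacity r s ω) = ∑' k, ENNReal.ofReal (r k s ω) := by
    filter_upwards [hJ.ae_isRegularAt hν, hr.ae_isFeasibleAt hon.measurable] with ω h1 h2
    exact ⟨h2.capacity_nonneg s, h2.ofReal_capacity h1 s⟩
  have hPm := measurable_capacity hon.measurable s
  have hXm : Measurable (J.jobSum f) := measurable_tsum_comp hJ.poisson.measurable_point hfm
  rw [hJ.poisson.lintegral_tsum_comp hK hmK hfm.ennreal_ofReal
    (fun x hx => by simp [hfK x hx]) |>.symm] at key
  rw [integral_eq_lintegral_of_nonneg_ae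
      (by filter_upwards [hP, hX0] with ω h1 h2 using mul_nonneg h1.1 h2)
      (hPm.mul hXm : Measurable fun ω => _ * _).aestronglyMeasurable,
    integral_eq_lintegral_of_nonneg_ae (hP.mono fun ω h => h.1) hPm.aestronglyMeasurable,
    integral_eq_lintegral_of_nonneg_ae hX0 hXm.aestronglyMeasurable, ← ENNReal.toReal_mul]
  congr 1
  calc ∫⁻ ω, ENNReal.ofReal (capacity r s ω * J.jobSum f ω) ∂μ
      = ∫⁻ ω, (∑' k, ENNReal.ofReal (r k s ω)) * ∑' k, ENNReal.ofReal (f (J.job k ω)) ∂μ := by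
        refine lintegral_congr_ae ?_
        filter_upwards [hP, hX] with ω h1 h2
        rw [ENNReal.ofReal_mul h1.1, h1.2, ← h2]
        rfl
    _ = _ := key
    _ = _ := by
        congr 1
        · exact lintegral_congr_ae (hP.mono fun ω h => h.2.symm)
        · exact lintegral_congr_ae (hX.mono fun ω h => h.symm)

/-- The variance of the backlog cannot grow linearly, so the capacity has to vary. -/
lemma mul_integral_sq_le_of_online (hrate : 0 ≤ rate) {D : ℝ}
    (hD : D = rate * ∫ p, p.2 * p.1 ^ 2 ∂ν + (rate * ∫ p, p.2 * p.1 ∂ν) ^ 2)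
    {lam : ℝ} (hlam : 0 < lam) {T : ℝ} (hT : 0 ≤ T) :
    T * (rate * ∫ p, p.1 ^ 2 ∂ν)
      ≤ D + lam * D * T + lam⁻¹ * ∫ t in (0 : ℝ)..T, Var[capacity r t; μ] := by
  have hm := hon.measurable
  have hgC : ∀ p : ℝ × ℝ, IsValidMark R p → p.1 ∈ Set.Icc 0 R :=
    fun p hp => fst_mem_Icc_of_validMark hp
  have hg : Measurable (Prod.fst : ℝ × ℝ → ℝ) := measurable_fst
  set A : ℝ → Ω → ℝ := fun t => J.jobSum ((arrivedJobs t).indicator fun x => x.2.1) with hA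
  set N : Ω → ℝ := J.jobSum ((arrivedJobs T).indicator fun _ => (1 : ℝ)) with hN
  set P : ℝ → Ω → ℝ := capacity r with hP
  set a : ℝ → ℝ := fun t => ∫ ω, A t ω ∂μ with ha
  set p : ℝ → ℝ := fun t => ∫ ω, P t ω ∂μ with hp
  have hALp : ∀ t, MemLp (A t) 2 μ := fun t =>
    memLp_jobSum hJ hν (measurableSet_arrivedJobs t) subset_rfl hg hgC
  have hNLp : MemLp N 2 μ := memLp_jobSum hJ hν (measurableSet_arrivedJobs T) subset_rfl
    (g := fun _ => 1) measurable_const (C := 1) fun p _ => ⟨zero_le_one, le_rfl⟩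
  have hPLp : ∀ t, MemLp (P t) 2 μ := memLp_capacity hJ hν hm hr
  have hPint : ∀ t, Integrable (P t) μ := fun t => (hPLp t).integrable one_le_two
  have hPN : ∀ᵐ ω ∂μ, ∀ s ∈ Set.Icc 0 T, 0 ≤ P s ω ∧ P s ω ≤ N ω := by
    filter_upwards [hJ.ae_isRegularAt hν, hr.ae_isFeasibleAt hm] with ω h1 h2 s hs
    exact ⟨h2.capacity_nonneg s, h2.capacity_le_arrived h1 hs.2⟩
  have hpN : ∀ s ∈ Set.Icc 0 T, 0 ≤ p s ∧ p s ≤ ∫ ω, N ω ∂μ := fun s hs =>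
    ⟨integral_nonneg_of_ae (hPN.mono fun ω h => (h s hs).1),
      integral_mono_ae (hPint s) (hNLp.integrable one_le_two) (hPN.mono fun ω h => (h s hs).2)⟩
  have hcLp : ∀ s, MemLp (fun ω => P s ω - p s) 2 μ := fun s => (hPLp s).sub (memLp_const _)
  have hc0 : ∀ s, ∫ ω, (P s ω - p s) ∂μ = 0 := fun s => by
    rw [integral_sub (hPint s) (integrable_const _)]
    simp [hp]
  have hvar : ∀ t, ∫ ω, (P t ω - p t) ^ 2 ∂μ = Var[P t; μ] := fun t =>
    (variance_eq_integral (hPLp t).aestronglyMeasurable.aemeasurable).symm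
  have hAvar : ∫ ω, (A T ω - a T) ^ 2 ∂μ = T * (rate * ∫ p, p.1 ^ 2 ∂ν) := by
    rw [← variance_eq_integral (hALp T).aestronglyMeasurable.aemeasurable,
      variance_jobSum hJ hν (measurableSet_arrivedJobs T) subset_rfl hg hgC hrate]
    simp only [volume_real_arrivedJobs hT, integral_mul_const]
    ring
  have henergy := integral_sq_le_of_energy (μ := μ) (c := fun s ω => P s ω - p s)
    (M := fun s ω => A s ω - a s) (G := fun ω => N ω + ∫ ω', N ω' ∂μ) (T := T) (D := D)
    (lam := lam) hT hlam
    ((measurable_capacity_uncurry hm).sub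
      ((measurable_integral_capacity hm).comp measurable_fst))
    (hNLp.add (memLp_const _)) ?_ (fun s => (hALp s).sub (memLp_const _)) ?_ ?_
  · simp only [hvar, hAvar] at henergy
    exact henergy
  · filter_upwards [hPN] with ω hω s hs
    have h1 := hω s hs
    have h2 := hpN s hs
    rw [abs_le]
    constructor <;> linarith
  · intro s hs
    -- `X` is the demand arriving in `(s, T]`; once centred, it is the increment of `M` and
    -- uncorrelated with the capacity at `s`.
    set X : Ω → ℝ := J.jobSum ((jobsBetween s T).indicator fun x => x.2.1) with hX
    have hXLp : MemLp X 2 μ :=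
      memLp_jobSum hJ hν (measurableSet_jobsBetween s T) (jobsBetween_subset s T) hg hgC
    have hXint := hXLp.integrable one_le_two
    have hAX : ∀ᵐ ω ∂μ, A T ω = A s ω + X ω := by
      filter_upwards [hJ.ae_isRegularAt hν] with ω h1
      simp only [hA, hX]
      rw [h1.jobSum_eq_sum (t := T) fun x hx => Set.indicator_of_notMem hx _,
        h1.jobSum_eq_sum (t := T) fun x hx => Set.indicator_of_notMem
          (s := arrivedJobs s) (fun hx' => hx (le_trans hx' hs.2)) _,
        h1.jobSum_eq_sum (t := T) fun x hx => Set.indicator_of_notMem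
          (fun hx' => hx (jobsBetween_subset s T hx')) _, ← Finset.sum_add_distrib]
      refine Finset.sum_congr rfl fun k hk => ?_
      have hkT : (J.job k ω).1 ≤ T := (h1.finite T).mem_toFinset.1 hk
      rw [Set.indicator_of_mem (show J.job k ω ∈ arrivedJobs T from hkT)]
      rcases le_or_gt (J.job k ω).1 s with h | h
      · rw [Set.indicator_of_mem (show J.job k ω ∈ arrivedJobs s from h),
          Set.indicator_of_notMem (fun h' => h'.1.not_ge h), add_zero]
      · rw [Set.indicator_of_notMem (show J.job k ω ∉ arrivedJobs s from fun h' => h.not_ge h'),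
          Set.indicator_of_mem (show J.job k ω ∈ jobsBetween s T from ⟨h, hkT⟩), zero_add]
    have haX : a T = a s + ∫ ω, X ω ∂μ := by
      simp only [ha]
      rw [integral_congr_ae hAX, integral_add ((hALp s).integrable one_le_two) hXint]
    have hXc : ∫ ω, (X ω - ∫ ω', X ω' ∂μ) * (P s ω - p s) ∂μ = 0 := by
      have e : ∀ ω, (X ω - ∫ ω', X ω' ∂μ) * (P s ω - p s)
          = (P s ω * X ω - p s * X ω) - (∫ ω', X ω' ∂μ) * (P s ω - p s) := fun ω => by ring
      have hPX : Integrable (fun ω => P s ω * X ω) μ := MemLp.integrable_mul (hPLp s) hXLp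
      have hPX' : Integrable (fun ω => P s ω * X ω - p s * X ω) μ := hPX.sub (hXint.const_mul _)
      simp only [e]
      rw [integral_sub hPX' (((hcLp s).integrable one_le_two).const_mul _), integral_sub hPX (hXint.const_mul _),
        integral_const_mul, integral_const_mul, hc0,
        integral_capacity_mul_jobSum_jobsBetween hJ hν hon hr s T]
      simp only [hp, hP]
      ring
    have hMint : Integrable (fun ω => (A s ω - a s) * (P s ω - p s)) μ :=
      MemLp.integrable_mul ((hALp s).sub (memLp_const (a s))) (hcLp s)
    have hXcint : Integrable (fun ω => (X ω - ∫ ω', X ω' ∂μ) * (P s ω - p s)) μ :=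
      MemLp.integrable_mul (hXLp.sub (memLp_const (∫ ω', X ω' ∂μ))) (hcLp s)
    calc ∫ ω, (A T ω - a T) * (P s ω - p s) ∂μ
        = ∫ ω, ((A s ω - a s) * (P s ω - p s)
            + (X ω - ∫ ω', X ω' ∂μ) * (P s ω - p s)) ∂μ := by
          refine integral_congr_ae (hAX.mono fun ω hω => ?_)
          simp only
          rw [hω, haX]
          ring
      _ = ∫ ω, (A s ω - a s) * (P s ω - p s) ∂μ := by
          rw [integral_add hMint hXcint, hXc, add_zero]
  · intro s hs
    obtain ⟨hswap, hpint, hCLp⟩ := integral_integral_capacity hJ hν hm hr hs.1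
    have hCint := hCLp.integrable one_le_two
    -- `Y` is the backlog. The tracking error is `Y` minus its mean, so its second moment is the
    -- variance of `Y`, bounded by `E Y²`.
    set Y : Ω → ℝ := fun ω => A s ω - ∫ u in (0 : ℝ)..s, P u ω with hY
    have hYLp : MemLp Y 2 μ := (hALp s).sub hCLp
    have hYmean : ∫ ω, Y ω ∂μ = a s - ∫ u in (0 : ℝ)..s, p u := by
      simp only [hY]
      rw [integral_sub ((hALp s).integrable one_le_two) hCint, hswap]
    have hYeq : ∀ᵐ ω ∂μ, A s ω - a s - ∫ u in (0 : ℝ)..s, (P u ω - p u) = Y ω - ∫ ω', Y ω' ∂μ := by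
      filter_upwards [hJ.ae_isRegularAt hν, hr.ae_isFeasibleAt hm] with ω h1 h2
      have hPi : IntervalIntegrable (fun u => P u ω) volume 0 s := by
        have : IntervalIntegrable (fun u => ∑ k ∈ (h1.finite s).toFinset, r k u ω) volume 0 s :=
          (integrable_finsetSum _ fun k _ => h2.integrable k).intervalIntegrable
        refine this.congr fun u hu => ?_
        rw [Set.uIoc_of_le hs.1] at hu
        exact (h2.capacity_eq_sum h1 hu.2).symm
      rw [intervalIntegral.integral_sub hPi hpint, hYmean]
      ring
    calc ∫ ω, (A s ω - a s - ∫ u in (0 : ℝ)..s, (P u ω - p u)) ^ 2 ∂μ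
        = Var[Y; μ] := by
          rw [variance_eq_integral hYLp.aestronglyMeasurable.aemeasurable]
          exact integral_congr_ae (hYeq.mono fun ω hω => by simp only [hω])
      _ ≤ ∫ ω, Y ω ^ 2 ∂μ := variance_le_expectation_sq hYLp.aestronglyMeasurable
      _ ≤ ∫ ω, J.jobSum ((activeJobs s).indicator fun x => x.2.1) ω ^ 2 ∂μ := by
          refine integral_mono_ae hYLp.integrable_sq (memLp_jobSum hJ hν
            (measurableSet_activeJobs s) (activeJobs_subset s) hg hgC).integrable_sq ?_
          filter_upwards [hJ.ae_isRegularAt hν, hr.ae_isFeasibleAt hm] with ω h1 h2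
          have h3 := h2.backlog_mem_Icc h1 hs.1
          exact pow_le_pow_left₀ h3.1 h3.2 2
      _ ≤ D := by
          rw [hD]
          exact integral_jobSum_activeJobs_sq_le hJ hν hrate s

/-- The lower bound on the long-run average variance of a centralized online policy. -/
lemma sq_le_mul_longRunVariance (hrate : 0 ≤ rate) :
    0 ≤ longRunVariance μ (capacity r) ∧
    (rate * ∫ p, p.1 ^ 2 ∂ν) ^ 2 ≤
      4 * (rate * ∫ p, p.2 * p.1 ^ 2 ∂ν + (rate * ∫ p, p.2 * p.1 ∂ν) ^ 2)
        * longRunVariance μ (capacity r) := by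
  obtain ⟨K, hK⟩ := exists_variance_capacity_le hJ hν hon.measurable hr
  have hD0 : 0 ≤ rate * ∫ p, p.2 * p.1 ^ 2 ∂ν + (rate * ∫ p, p.2 * p.1 ∂ν) ^ 2 :=
    add_nonneg (mul_nonneg hrate (integral_nonneg_of_ae (hν.mono fun p hp =>
      mul_nonneg (hp.1.trans hp.2.1) (sq_nonneg _)))) (sq_nonneg _)
  exact sq_le_mul_liminf_average (fun t => variance_nonneg _ _) hK
    (measurable_variance_capacity hon.measurable)
    (mul_nonneg hrate (integral_nonneg fun p => sq_nonneg _)) hD0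
    fun lam hlam T hT => mul_integral_sq_le_of_online hJ hν hon hr hrate rfl hlam hT.le

omit hon in
-- Uniform fourth moments make `Var (P t)` converge to `v`, so lower bounds on the long-run variance
-- also hold for the stationary variance.
lemma longRunVariance_le_of_hasStationaryVariance
    (hm : ∀ k, Measurable fun p : ℝ × Ω => r k p.1 p.2) {v : ℝ}
    (hv : HasStationaryVariance μ (capacity r) v) : longRunVariance μ (capacity r) ≤ v := by
  obtain ⟨C, hC⟩ := exists_integral_capacity_pow_four_le hJ hν hm hr
  obtain ⟨K, hK⟩ := exists_variance_capacity_le hJ hν hm hr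
  exact liminf_average_le_of_tendsto (fun t => variance_nonneg _ _) hK
    (measurable_variance_capacity hm)
    (hv.tendsto_variance (fun t => (hC t).1) fun t => (hC t).2)

end JobStream

/-! ### Exact Scheduling -/

/-- A rate that always equals remaining demand over remaining time is constant. -/
lemma eq_div_of_exactScheduling {ρ : ℝ → ℝ} (hρ : Integrable ρ) {a σ τ : ℝ}
    (h : ∀ t, a ≤ t → ρ t = exactScheduling (σ - ∫ s in a..t, ρ s) (a + τ - t)) {t : ℝ}
    (hat : a ≤ t) (htτ : t < a + τ) : ρ t = σ / τ := by
  set y : ℝ → ℝ := fun t => σ - ∫ s in a..t, ρ s with hy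
  set q : ℝ → ℝ := fun t => y t / (a + τ - t) with hq
  have hρq : ∀ s, a ≤ s → s < a + τ → ρ s = q s := fun s has hsτ => by
    rw [h s has, exactScheduling, if_pos (by linarith)]
  have hyc : Continuous y :=
    continuous_const.sub (intervalIntegral.continuous_primitive
      (fun _ _ => hρ.intervalIntegrable) a)
  have hqc : ∀ s, s < a + τ → ContinuousAt q s := fun s hs =>
    hyc.continuousAt.div (continuousAt_const.sub continuousAt_id)
      (sub_ne_zero.2 hs.ne')
  -- The rate `ρ` is only assumed integrable, but it coincides with the continuous `q` from time `a`
  -- until the deadline, which gives a right derivative. The quotient rule shows that it vanishes,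
  -- because `ρ = q`.
  have hderiv : ∀ s ∈ Set.Ico a t, HasDerivWithinAt q 0 (Set.Ici s) s := by
    intro s hs
    have hsτ : s < a + τ := hs.2.trans htτ
    have hne : a + τ - s ≠ 0 := by linarith
    have hcw : ContinuousWithinAt ρ (Set.Ici s) s := by
      refine (hqc s hsτ).continuousWithinAt.congr_of_eventuallyEq ?_ (hρq s hs.1 hsτ)
      filter_upwards [self_mem_nhdsWithin, mem_nhdsWithin_of_mem_nhds (Iio_mem_nhds hsτ)]
        with u hu1 hu2
      exact hρq u (hs.1.trans hu1) hu2
    have h1 : HasDerivWithinAt (fun u => ∫ s in a..u, ρ s) (ρ s) (Set.Ici s) s :=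
      intervalIntegral.integral_hasDerivWithinAt_right hρ.intervalIntegrable
        (t := Set.Ioi s) ⟨Set.univ, univ_mem, hρ.aestronglyMeasurable.restrict⟩
        (hcw.mono Set.Ioi_subset_Ici_self)
    have h2 : HasDerivWithinAt (fun u => a + τ - u) (-1) (Set.Ici s) s :=
      (hasDerivWithinAt_id s _).const_sub (a + τ)
    have h3 := (h1.const_sub σ).div h2 hne
    have h4 : (-ρ s * (a + τ - s) - (σ - ∫ u in a..s, ρ u) * -1) / (a + τ - s) ^ 2 = 0 := by
      rw [hρq s hs.1 hsτ]
      simp only [hq, hy]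
      field_simp
      ring
    rw [h4] at h3
    exact h3
  have hconst := constant_of_has_deriv_right_zero (f := q)
    (fun s hs => (hqc s (hs.2.trans_lt htτ)).continuousWithinAt) hderiv t ⟨hat, le_rfl⟩
  rw [hρq t hat htτ, hconst]
  simp [hq, hy]

namespace JobStream

/-! ### Existence and uniqueness of the Exact Scheduling rates -/

section Profile

variable {Ω : Type*} {J : JobStream Ω} {r : ℕ → ℝ → Ω → ℝ}

/-- The service rate of a job under Exact Scheduling. -/
noncomputable def exactRate (t : ℝ) : ℝ × ℝ × ℝ → ℝ :=
  (activeJobs t).indicator fun x => x.2.1 / x.2.2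

lemma exactRate_job_eq_indicator (J : JobStream Ω) (k : ℕ) (t : ℝ) (ω : Ω) :
    exactRate t (J.job k ω)
      = (Set.Ico (J.arrival k ω) (J.arrival k ω + J.sojourn k ω)).indicator
        (fun _ => J.demand k ω / J.sojourn k ω) t := rfl

lemma FollowsDistributed.eq_exactRate (hr : J.FollowsDistributed exactScheduling r) (k : ℕ)
    (t : ℝ) (ω : Ω) : r k t ω = exactRate t (J.job k ω) := by
  rw [exactRate_job_eq_indicator]
  by_cases hat : J.arrival k ω ≤ t
  · by_cases htτ : t < J.arrival k ω + J.sojourn k ω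
    · rw [Set.indicator_of_mem (Set.mem_Ico.2 ⟨hat, htτ⟩)]
      exact eq_div_of_exactScheduling (ρ := fun t => r k t ω) (hr.integrable k ω)
        (fun s hs => hr.after k s ω hs) hat htτ
    · rw [Set.indicator_of_notMem fun h => htτ h.2, hr.after k t ω hat, exactScheduling,
        if_neg]
      unfold remainingTime
      linarith
  · rw [Set.indicator_of_notMem fun h => hat h.1]
    exact hr.before k t ω (not_le.1 hat)

lemma followsDistributed_exactRate (J : JobStream Ω) :
    J.FollowsDistributed exactScheduling fun k t ω => exactRate t (J.job k ω) where
  integrable k ω := by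
    simp only [exactRate_job_eq_indicator]
    exact (integrable_indicator_iff measurableSet_Ico).2 (integrableOn_const (by simp))
  after k t ω hat := by
    unfold remainingDemand remainingTime exactScheduling
    simp only [exactRate_job_eq_indicator]
    by_cases htτ : t < J.arrival k ω + J.sojourn k ω
    · rw [Set.indicator_of_mem (Set.mem_Ico.2 ⟨hat, htτ⟩), if_pos (by linarith)]
      have hint : ∫ s in J.arrival k ω..t, (Set.Ico (J.arrival k ω)
          (J.arrival k ω + J.sojourn k ω)).indicator
            (fun _ => J.demand k ω / J.sojourn k ω) s
          = (t - J.arrival k ω) * (J.demand k ω / J.sojourn k ω) := by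
        rw [← smul_eq_mul, ← intervalIntegral.integral_const]
        refine intervalIntegral.integral_congr fun s hs => ?_
        rw [Set.uIcc_of_le hat] at hs
        exact Set.indicator_of_mem (Set.mem_Ico.2 ⟨hs.1, hs.2.trans_lt htτ⟩) _
      rw [hint]
      have h1 : J.sojourn k ω ≠ 0 := by linarith
      have h2 : J.arrival k ω + J.sojourn k ω - t ≠ 0 := by linarith
      field_simp
      ring
    · rw [Set.indicator_of_notMem fun h => htτ h.2, if_neg (by linarith)]
  before k t ω hta := by
    rw [exactRate_job_eq_indicator]
    exact Set.indicator_of_notMem (fun h => h.1.not_gt hta) _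

lemma FollowsDistributed.capacity_eq (hr : J.FollowsDistributed exactScheduling r) (t : ℝ) :
    capacity r t = J.jobSum (exactRate t) := by
  funext ω
  unfold capacity jobSum
  simp only [hr.eq_exactRate]

end Profile

/-! ### Exact Scheduling as an admissible centralized online policy -/

section Policy

variable {Ω : Type*} [MeasurableSpace Ω] {μ : Measure Ω} {J : JobStream Ω} {rate R : ℝ}
  {ν : Measure (ℝ × ℝ)} {r : ℕ → ℝ → Ω → ℝ}

lemma measurable_exactRate (t : ℝ) : Measurable (exactRate t) :=
  (measurable_snd.fst.div measurable_snd.snd).indicator (measurableSet_activeJobs t)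

omit [MeasurableSpace Ω] in
-- As `f` vanishes on jobs yet to arrive, the preimage of `C` is a generating event if `0 ∉ C` and
-- the complement of one if `0 ∈ C`.
lemma measurable_past_comp_job (J : JobStream Ω) {t : ℝ} {f : ℝ × ℝ × ℝ → ℝ} (hf : Measurable f)
    (hft : ∀ x, x ∉ arrivedJobs t → f x = 0) (k : ℕ) :
    Measurable[J.past t] fun ω => f (J.job k ω) := by
  have hgen : ∀ B, MeasurableSet B →
      MeasurableSet[J.past t] {ω | J.arrival k ω ≤ t ∧ J.job k ω ∈ B} := fun B hB =>
    MeasurableSpace.measurableSet_generateFrom ⟨k, B, hB, rfl⟩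
  intro C hC
  by_cases h0 : (0 : ℝ) ∈ C
  · have : (fun ω => f (J.job k ω)) ⁻¹' C
        = {ω | J.arrival k ω ≤ t ∧ J.job k ω ∈ (f ⁻¹' C)ᶜ}ᶜ := by
      ext ω
      simp only [Set.mem_preimage, Set.mem_compl_iff, Set.mem_ofPred_eq, not_and, not_not]
      refine ⟨fun h _ => h, fun h => ?_⟩
      by_cases ht : J.arrival k ω ≤ t
      · exact h ht
      · rw [hft _ ht]
        exact h0
    rw [this]
    exact (hgen _ (hf hC).compl).compl
  · have : (fun ω => f (J.job k ω)) ⁻¹' C = {ω | J.arrival k ω ≤ t ∧ J.job k ω ∈ f ⁻¹' C} := by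
      ext ω
      simp only [Set.mem_preimage, Set.mem_ofPred_eq]
      refine ⟨fun h => ⟨?_, h⟩, fun h => h.2⟩
      by_contra ht
      rw [hft _ ht] at h
      exact h0 h
    rw [this]
    exact hgen _ (hf hC)

lemma FollowsDistributed.isCentralizedOnline (hr : J.FollowsDistributed exactScheduling r)
    (hJ : J.IsStationaryPoisson μ rate ν) : J.IsCentralizedOnline μ r where
  form := by
    classical
    -- The policy looks up an entry with label `k`. Labels are unique in the information set, so the
    -- choice is the entry of job `k`; no entry means that the job has not arrived.
    refine ⟨fun k _ I => if h : ∃ p ∈ I, p.label = k then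
      exactScheduling h.choose.remDemand h.choose.remTime else 0,
      Eventually.of_forall fun ω k t => ?_⟩
    by_cases hat : J.arrival k ω ≤ t
    · have h : ∃ p ∈ J.info r t ω, p.label = k := ⟨_, ⟨k, hat, rfl⟩, rfl⟩
      simp only
      rw [dif_pos h, hr.after k t ω hat]
      obtain ⟨⟨k', hk', hp⟩, hlabel⟩ := h.choose_spec
      have hkk : k' = k := by
        rw [hp] at hlabel
        exact hlabel
      subst hkk
      rw [hp]
    · simp only
      rw [dif_neg, hr.before k t ω (not_le.1 hat)]
      rintro ⟨p, ⟨k', hk', rfl⟩, rfl⟩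
      exact hat hk'
  measurable k := by
    have hjob := hJ.poisson.measurable_point k
    have ha : Measurable fun p : ℝ × Ω => J.arrival k p.2 :=
      measurable_fst.comp (hjob.comp measurable_snd)
    have hσ : Measurable fun p : ℝ × Ω => J.demand k p.2 :=
      measurable_snd.fst.comp (hjob.comp measurable_snd)
    have hτ : Measurable fun p : ℝ × Ω => J.sojourn k p.2 :=
      measurable_snd.snd.comp (hjob.comp measurable_snd)
    simp only [hr.eq_exactRate]
    exact (hσ.div hτ).indicator ((measurableSet_le ha measurable_fst).inter
      (measurableSet_lt measurable_fst (ha.add hτ)))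
  adapted k t := by
    have := measurable_past_comp_job J (measurable_exactRate t)
      (fun x hx => Set.indicator_of_notMem (fun h => hx (activeJobs_subset t h)) _) k
    convert this using 1
    funext ω
    exact hr.eq_exactRate k t ω

lemma div_mem_Icc_of_validMark {p : ℝ × ℝ} (hp : IsValidMark R p) : p.1 / p.2 ∈ Set.Icc 0 1 :=
  ⟨div_nonneg hp.1 (hp.1.trans hp.2.1), div_le_one_of_le₀ hp.2.1 (hp.1.trans hp.2.1)⟩

lemma FollowsDistributed.meetsConstraints [IsProbabilityMeasure ν]
    (hr : J.FollowsDistributed exactScheduling r)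
    (hJ : J.IsStationaryPoisson μ rate ν) (hν : ∀ᵐ p ∂ν, IsValidMark R p) :
    J.MeetsConstraints μ r where
  rate := by
    filter_upwards [hJ.ae_isRegularAt hν] with ω hω k t
    have h := div_mem_Icc_of_validMark (hω.mark k)
    rw [hr.eq_exactRate, exactRate_job_eq_indicator]
    exact ⟨Set.indicator_nonneg (fun _ _ => h.1) _,
      Set.indicator_apply_le' (fun _ => h.2) fun _ => zero_le_one⟩
  demand := by
    filter_upwards [hJ.ae_isRegularAt hν] with ω hω k
    simp only [hr.eq_exactRate, exactRate_job_eq_indicator]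
    obtain ⟨h1, h2, -⟩ := hω.mark k
    simp only at h1 h2
    rw [setIntegral_indicator measurableSet_Ico, Set.inter_eq_right.2 Set.Ico_subset_Ici_self,
      setIntegral_const, Real.volume_real_Ico_of_le (by linarith), add_sub_cancel_left,
      smul_eq_mul]
    -- A job with sojourn time 0 has demand 0, so its empty service window suffices.
    rcases eq_or_ne (J.sojourn k ω) 0 with h0 | h0
    · rw [h0] at h2 ⊢
      linarith
    · field_simp
  deadline := by
    filter_upwards [hJ.ae_isRegularAt hν] with ω hω k t
    rw [hr.eq_exactRate, exactRate_job_eq_indicator]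
    exact Set.indicator_le_indicator (div_mem_Icc_of_validMark (hω.mark k)).2

end Policy

/-! ### The stationary law under Exact Scheduling -/

section Stationary

variable {Ω : Type*} [MeasurableSpace Ω] {μ : Measure Ω} [IsProbabilityMeasure μ]
  {J : JobStream Ω} {rate R : ℝ} {ν : Measure (ℝ × ℝ)} [IsProbabilityMeasure ν]
  (hJ : J.IsStationaryPoisson μ rate ν) (hν : ∀ᵐ p ∂ν, IsValidMark R p)

omit [IsProbabilityMeasure ν] in
/-- The intensity of the jobs present at time `t` with marks in `C` does not depend on `t`. -/
lemma jobIntensity_activeJobs_inter [SFinite ν] {C : Set (ℝ × ℝ)} (hC : MeasurableSet C)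
    (hν : ∀ᵐ p ∂ν, IsValidMark R p) {t : ℝ} (ht : R ≤ t) :
    jobIntensity rate ν (activeJobs t ∩ Prod.snd ⁻¹' C)
      = ∫⁻ p, C.indicator (fun p => ENNReal.ofReal rate * ENNReal.ofReal p.2) p ∂ν := by
  rw [Measure.prod_apply_symm ((measurableSet_activeJobs t).inter (measurable_snd hC))]
  refine lintegral_congr_ae (hν.mono fun p hp => ?_)
  simp only
  by_cases hpC : p ∈ C
  · rw [Set.indicator_of_mem hpC, Measure.smul_apply, smul_eq_mul,
      Measure.restrict_apply' measurableSet_Ici]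
    have : (fun a : ℝ => (a, p)) ⁻¹' (activeJobs t ∩ Prod.snd ⁻¹' C) ∩ Set.Ici 0
        = Set.Ioc (t - p.2) t := by
      ext a
      simp only [activeJobs, Set.mem_inter_iff, Set.mem_preimage, Set.mem_ofPred_eq, Set.mem_Ici,
        Set.mem_Ioc, hpC, and_true]
      have := hp.2.2
      constructor
      · rintro ⟨⟨h1, h2⟩, h3⟩
        exact ⟨by linarith, h1⟩
      · rintro ⟨h1, h2⟩
        exact ⟨⟨h2, by linarith⟩, by linarith⟩
    rw [this, Real.volume_Ioc, sub_sub_cancel]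
  · rw [Set.indicator_of_notMem hpC]
    have : (fun a : ℝ => (a, p)) ⁻¹' (activeJobs t ∩ Prod.snd ⁻¹' C) = ∅ := by
      ext a
      simp [hpC]
    rw [this, measure_empty]

include hJ hν

/-- Under Exact Scheduling the law of the capacity does not depend on time from `R` on. -/
lemma map_jobSum_exactRate_eq {s t : ℝ} (hs : R ≤ s) (ht : R ≤ t) :
    μ.map (J.jobSum (exactRate s)) = μ.map (J.jobSum (exactRate t)) := by
  -- The comparison of laws needs values in `[0, 1]` everywhere, while `σ/τ` lies there only for
  -- valid marks; clamping changes the sum on a null set only.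
  let g : ℝ × ℝ → ℝ := fun p => max 0 (min 1 (p.1 / p.2))
  have hg : Measurable g :=
    measurable_const.max (measurable_const.min (measurable_fst.div measurable_snd))
  let f : ℝ → ℝ × ℝ × ℝ → ℝ := fun t => (activeJobs t).indicator fun x => g x.2
  have hf : ∀ t, Measurable (f t) := fun t =>
    (hg.comp measurable_snd).indicator (measurableSet_activeJobs t)
  have hf01 : ∀ t x, f t x ∈ Set.Icc (0 : ℝ) 1 := fun t x => by
    have h : g x.2 ∈ Set.Icc (0 : ℝ) 1 :=
      ⟨le_max_left _ _, max_le zero_le_one (min_le_left _ _)⟩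
    by_cases hx : x ∈ activeJobs t
    · simpa only [f, Set.indicator_of_mem hx] using h
    · simp only [f, Set.indicator_of_notMem hx]
      exact ⟨le_rfl, zero_le_one⟩
  have hfK : ∀ t x, x ∉ arrivedJobs t → f t x = 0 := fun t x hx =>
    Set.indicator_of_notMem (fun h => hx (activeJobs_subset t h)) _
  have hae : ∀ t, J.jobSum (exactRate t) =ᵐ[μ] fun ω => ∑' k, f t (J.job k ω) := fun t => by
    filter_upwards [hJ.ae_isRegularAt hν] with ω hω
    refine tsum_congr fun k => ?_
    have h : (J.job k ω).2.1 / (J.job k ω).2.2 ∈ Set.Icc 0 1 :=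
      div_mem_Icc_of_validMark (hω.mark k)
    have hgk : g (J.job k ω).2 = (J.job k ω).2.1 / (J.job k ω).2.2 := by
      simp only [g]
      rw [min_eq_right h.2, max_eq_right h.1]
    by_cases hx : J.job k ω ∈ activeJobs t
    · simp only [exactRate, f, Set.indicator_of_mem hx, hgk]
    · simp only [exactRate, f, Set.indicator_of_notMem hx]
  rw [Measure.map_congr (hae s), Measure.map_congr (hae t)]
  refine hJ.poisson.map_tsum_comp_eq (hf s) (hf t) (hf01 s) (hf01 t)
    (measurableSet_arrivedJobs s) (jobIntensity_arrivedJobs_lt_top s) (hfK s)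
    (measurableSet_arrivedJobs t) (jobIntensity_arrivedJobs_lt_top t) (hfK t) fun C hC h0 => ?_
  have hpre : ∀ t, f t ⁻¹' C = activeJobs t ∩ Prod.snd ⁻¹' (g ⁻¹' C) := fun t => by
    ext x
    by_cases hx : x ∈ activeJobs t
    · simp [f, hx]
    · simp [f, hx, h0]
  rw [hpre, hpre, jobIntensity_activeJobs_inter (hg hC) hν hs,
    jobIntensity_activeJobs_inter (hg hC) hν ht]

/-- The law is constant from time `R` on, so the law at time `R` serves as the limit law. -/
lemma FollowsDistributed.hasStationaryVariance (hrate : 0 ≤ rate) {r : ℕ → ℝ → Ω → ℝ}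
    (hr : J.FollowsDistributed exactScheduling r) :
    HasStationaryVariance μ (capacity r) (rate * ∫ p, p.1 ^ 2 / p.2 ∂ν) := by
  have hm : ∀ t, Measurable (J.jobSum (exactRate t)) := fun t =>
    measurable_tsum_comp hJ.poisson.measurable_point (measurable_exactRate t)
  have hcap : capacity r = fun t => J.jobSum (exactRate t) := funext hr.capacity_eq
  have hg : Measurable fun p : ℝ × ℝ => p.1 / p.2 := measurable_fst.div measurable_snd
  have hgC : ∀ p : ℝ × ℝ, IsValidMark R p → p.1 / p.2 ∈ Set.Icc (0 : ℝ) 1 :=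
    fun p hp => div_mem_Icc_of_validMark hp
  have hLp : MemLp (J.jobSum (exactRate R)) 2 μ :=
    memLp_jobSum hJ hν (measurableSet_activeJobs R) (activeJobs_subset R) hg hgC
  have hprob : IsProbabilityMeasure (μ.map (J.jobSum (exactRate R))) :=
    Measure.isProbabilityMeasure_map (hm R).aemeasurable
  rw [hcap]
  refine ⟨μ.map (J.jobSum (exactRate R)), hprob, ⟨fun t => (hm t).aemeasurable,
    aemeasurable_id, ?_⟩, ?_, ?_⟩
  · refine tendsto_const_nhds.congr' ?_
    filter_upwards [eventually_ge_atTop R] with t ht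
    refine Subtype.ext ?_
    change (μ.map (J.jobSum (exactRate R))).map id = μ.map (J.jobSum (exactRate t))
    rw [Measure.map_id]
    exact map_jobSum_exactRate_eq hJ hν le_rfl ht
  · rw [memLp_map_measure_iff aestronglyMeasurable_id (hm R).aemeasurable]
    exact hLp
  · rw [variance_id_map (hm R).aemeasurable]
    refine (variance_jobSum hJ hν (measurableSet_activeJobs R) (activeJobs_subset R) hg hgC
      hrate).trans ?_
    congr 1
    refine integral_congr_ae (hν.mono fun p hp => ?_)
    simp only
    rw [volume_real_activeJobs (hp.1.trans hp.2.1) hp.2.2]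
    -- `(σ/τ)² τ = σ²/τ` also holds at `τ = 0`, where division by zero gives 0.
    rcases eq_or_ne p.2 0 with h0 | h0
    · simp [h0]
    · field_simp

end Stationary

end JobStream

/-! ### The competitive ratio -/

/-- Each `v` in `A` is at least `rate * s² / (4 * d)`, and so is the infimum. Nonemptiness matters
because `sInf ∅ = 0`. If `s = 0`, both sides vanish. -/
lemma mul_le_ratio_mul_sInf {rate e d s : ℝ} (hrate : 0 < rate) (he : 0 ≤ e) (hd : 0 ≤ d)
    (hs : s = 0 → e = 0) {A : Set ℝ} (hA : A.Nonempty)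
    (h : ∀ v ∈ A, (rate * s) ^ 2 ≤ 4 * (rate * d) * v) :
    rate * e ≤ 4 * e * d / s ^ 2 * sInf A := by
  rcases eq_or_ne s 0 with hs0 | hs0
  · simp [hs hs0]
  · have hd0 : d ≠ 0 := by
      rintro rfl
      obtain ⟨v, hv⟩ := hA
      have h1 := h v hv
      have h2 : 0 < (rate * s) ^ 2 := by positivity
      simp only [mul_zero, zero_mul] at h1
      linarith
    have hd' : 0 < d := lt_of_le_of_ne hd (Ne.symm hd0)
    have hle : rate * s ^ 2 / (4 * d) ≤ sInf A := by
      refine le_csInf hA fun v hv => ?_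
      rw [div_le_iff₀ (by positivity)]
      have h1 := h v hv
      refine le_of_mul_le_mul_left ?_ hrate
      linarith
    calc rate * e = 4 * e * d / s ^ 2 * (rate * s ^ 2 / (4 * d)) := by field_simp
      _ ≤ _ := mul_le_mul_of_nonneg_left hle (by positivity)

theorem corollary3 {Ω : Type*} [MeasurableSpace Ω] (μ : Measure Ω) [IsProbabilityMeasure μ]
    (rate : ℝ) (hrate : 0 < rate)
    (ν : Measure (ℝ × ℝ)) [IsProbabilityMeasure ν]
    (S : Set (ℝ × ℝ)) (hS_bounded : Bornology.IsBounded S)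
    (hS : ∀ p ∈ S, 0 ≤ p.1 ∧ p.1 ≤ p.2) (hν : ∀ᵐ p ∂ν, p ∈ S)
    (J : JobStream Ω) (hJ : J.IsStationaryPoisson μ rate ν) :
    (∃ r, J.FollowsDistributed exactScheduling r) ∧
    ∀ r, J.FollowsDistributed exactScheduling r →
      ∃ V : ℝ, HasStationaryVariance μ (capacity r) V ∧
        V ≤ 4 * (∫ p, p.1 ^ 2 / p.2 ∂ν) *
              ((∫ p, p.2 * p.1 ^ 2 ∂ν) + rate * (∫ p, p.2 * p.1 ∂ν) ^ 2) /
              (∫ p, p.1 ^ 2 ∂ν) ^ 2 * optimalCentralizedVariance μ J ∧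
        V ≤ 4 * (∫ p, p.1 ^ 2 / p.2 ∂ν) *
              ((∫ p, p.2 * p.1 ^ 2 ∂ν) + rate * (∫ p, p.2 * p.1 ∂ν) ^ 2) /
              (∫ p, p.1 ^ 2 ∂ν) ^ 2 * optimalCentralizedLongRunVariance μ J := by
  refine ⟨⟨_, J.followsDistributed_exactRate⟩, fun r hr => ?_⟩
  obtain ⟨R, hR⟩ := isBounded_iff_forall_norm_le.1 hS_bounded
  have hν' : ∀ᵐ p ∂ν, IsValidMark R p := hν.mono fun p hp =>
    ⟨(hS p hp).1, (hS p hp).2, (le_abs_self p.2).trans ((norm_snd_le p).trans (hR p hp))⟩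
  have hon := hr.isCentralizedOnline hJ
  have hcon := hr.meetsConstraints hJ hν'
  have hstat := hr.hasStationaryVariance hJ hν' hrate.le
  have he : 0 ≤ ∫ p, p.1 ^ 2 / p.2 ∂ν := integral_nonneg_of_ae (hν'.mono fun p hp =>
    div_nonneg (sq_nonneg _) (hp.1.trans hp.2.1))
  have hd : 0 ≤ (∫ p, p.2 * p.1 ^ 2 ∂ν) + rate * (∫ p, p.2 * p.1 ∂ν) ^ 2 :=
    add_nonneg (integral_nonneg_of_ae (hν'.mono fun p hp =>
      mul_nonneg (hp.1.trans hp.2.1) (sq_nonneg _))) (by positivity)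
  have hs : ∫ p, p.1 ^ 2 ∂ν = 0 → ∫ p, p.1 ^ 2 / p.2 ∂ν = 0 := by
    intro h0
    have hint : Integrable (fun p : ℝ × ℝ => p.1 ^ 2) ν :=
      JobStream.integrable_of_validMark hν' (measurable_fst.pow_const 2) (C := R ^ 2) fun p hp =>
        ⟨sq_nonneg _, pow_le_pow_left₀ hp.1 (hp.2.1.trans hp.2.2) 2⟩
    have h1 := (integral_eq_zero_iff_of_nonneg (fun p => sq_nonneg _) hint).1 h0
    refine integral_eq_zero_of_ae (h1.mono fun p hp => ?_)
    have hp' : p.1 ^ 2 = 0 := hp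
    simp [hp']
  have hbound : ∀ r', J.IsCentralizedOnline μ r' → J.MeetsConstraints μ r' →
      0 ≤ (rate * ((∫ p, p.2 * p.1 ^ 2 ∂ν) + rate * (∫ p, p.2 * p.1 ∂ν) ^ 2)) ∧
      (rate * ∫ p, p.1 ^ 2 ∂ν) ^ 2
        ≤ 4 * (rate * ((∫ p, p.2 * p.1 ^ 2 ∂ν) + rate * (∫ p, p.2 * p.1 ∂ν) ^ 2))
          * longRunVariance μ (capacity r') := fun r' h1 h2 => by
    refine ⟨mul_nonneg hrate.le hd, ?_⟩
    refine (JobStream.sq_le_mul_longRunVariance hJ hν' h1 h2 hrate.le).2.trans (le_of_eq ?_)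
    ring
  refine ⟨_, hstat, ?_, ?_⟩
  -- Exact Scheduling itself is admissible, so the set of attained variances is nonempty.
  · refine mul_le_ratio_mul_sInf hrate he hd hs ⟨_, r, hon, hcon, hstat⟩ ?_
    rintro v ⟨r', h1, h2, h3⟩
    refine (hbound r' h1 h2).2.trans (mul_le_mul_of_nonneg_left ?_
      (mul_nonneg (by norm_num) (hbound r' h1 h2).1))
    exact JobStream.longRunVariance_le_of_hasStationaryVariance hJ hν' h2 h1.measurable h3
  · refine mul_le_ratio_mul_sInf hrate he hd hs ⟨_, r, hon, hcon, rfl⟩ ?_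
    rintro v ⟨r', h1, h2, rfl⟩
    exact (hbound r' h1 h2).2
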